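/- **Setting.** Let $d_z\le d_x$, $d_a$, $T$ be natural numbers, $\mathcal A\subseteq\mathbb R^{d_a}$, and let $\sigma^2\ge 0$ be fixed. A *model* $\theta$ consists of a decoder $f:\mathbb R^{d_z}\to\mathbb R^{d_x}$, mechanisms $p(z_i^t\mid z^{<t},a^{<t})$ for $t\in[T]$, $i\in[d_z]$, where $z^{<t}=(z^1,\dots,z^{t-1})\in\mathbb R^{d_z\times(t-1)}$ and $a^{<t}=(a^0,\dots,a^{t-1})\in\mathcal A^t$, and binary matrices $G^z\in\{0,1\}^{d_z\times d_z}$, $G^a\in\{0,1\}^{d_z\times d_a}$. Given $a^{<T}\in\mathcal A^T$, the latent trajectory has density $\prod_t p(z^t\mid z^{<t},a^{<t})$ with $p(z^t\mid z^{<t},a^{<t})=\prod_i p(z_i^t\mid z^{<t},a^{<t})$, and the observations are $x^t=f(z^t)+n^t$, where the $n^t\sim\mathcal N(0,\sigma^2I)$ are independent of each other and of the latents. A map is a *diffeomorphism onto its image* if it is $C^1$ and injective and its inverse is the restriction of a $C^1$ map on an open neighbourhood of the image. For matrices, $M\subseteq N$ means that $N_{ij}\neq0$ whenever $M_{ij}\ne0$;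 $\|M\|_0$ is the number of nonzero entries; $\mathbb R^{m\times n}_{B}=\{M: B_{ij}=0\Rightarrow M_{ij}=0\}$. A matrix $C$ is *$G$-preserving* if $C^\top\mathbb R^{m\times n}_G\subseteq\mathbb R^{m\times n}_G$; a map $c:\mathbb R^m\to\mathbb R^m$ is $G$-preserving if its dependency graph is (the binary matrix whose $(i,j)$ entry is $0$ exactly when $c_i$ does not depend on the $j$-th coordinate). **Assumptions.** Let $\theta=(f,p,G)$ and $\hat\theta=(\hat f,\hat p,\hat G)$ be two models such that, for each of them: (a) the decoder is a diffeomorphism onto its image, and this image is closed; (b) for every past, each mechanism is a probability density on $\mathbb R$ with support $\mathbb R$; (c) $p(z_i^t\mid z^{<t},a^{<t})$ depends on $z^{<t}$ and $a^{<t}$ only through the coordinates $j$ with $G^z_{ij}=1$ and the coordinates $\ell$ with $G^a_{i\ell}=1$, respectively; (d) for every $a^{<t}\in\mathcal A^t$, $p(z_i^t\mid z^{<t},a^{<t})$ is a $C^2$ function of $(z_i^t,z^{<t})$; (e) $p(z_i^t\mid z^{<t},a^{<t})=h_i(z_i^t)\exp\{s_i(z_i^t)\lambda_i(z^{<t},a^{<t})-\psi_i(z^{<t},a^{<t})\}$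 with one-dimensional sufficient statistics $s_i:\mathbb R\to\mathbb R$ and base measures $h_i$ common to both models; the natural parameters and normalization constants are $\lambda,\psi$ for $\theta$ and $\hat\lambda,\hat\psi$ for $\hat\theta$. Write $s(z)=(s_1(z_1),\dots,s_{d_z}(z_{d_z}))$. Assume further: 1. $\theta$ and $\hat\theta$ are observationally equivalent: for every $a^{<T}\in\mathcal A^T$ they give $x^{\le T}$ the same law; 2. every $s_i$ is minimal (no nonzero multiple of it is constant), and $s$ is a diffeomorphism from $\mathbb R^{d_z}$ onto $s(\mathbb R^{d_z})$; 3. (sufficient variability) there are histories $(z_{(r)},a_{(r)})_{r=0}^{d_z}$, possibly of different time steps, such that the vectors $\lambda(z_{(r)},a_{(r)})-\lambda(z_{(0)},a_{(0)})$, $1\le r\le d_z$, are linearly independent; 4. (sufficient influence of $z$) $Ds$ is invertible everywhere and there are histories $(z_{(r)},a_{(r)})$ with time indices $\tau_{(r)}$ in them, $1\le r\le\|G^z\|_0$, such that $$\mathrm{span}\big\{D_z^{\tau_{(r)}}\lambda(z_{(r)},a_{(r)})\,Ds\big(z_{(r)}^{\tau_{(r)}}\big)^{-1}\big\}_{r=1}^{\|G^z\|_0}=\mathbb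 R^{d_z\times d_z}_{G^z},$$ where $D^\tau_z\lambda$ is the Jacobian of $\lambda$ with respect to $z^\tau$. **Conclusion.** There is a permutation matrix $P$ with $PG^zP^\top\subseteq\hat G^z$. If moreover $\|\hat G^z\|_0\le\|G^z\|_0$, then for the same $P$ and with $v:=f^{-1}\circ\hat f$: - $\theta$ and $\hat\theta$ are equivalent up to diffeomorphism, i.e. $f(\mathbb R^{d_z})=\hat f(\mathbb R^{d_z})$, $v$ is a diffeomorphism of $\mathbb R^{d_z}$, and $\hat p(z^t\mid z^{<t},a^{<t})=p(v(z^t)\mid v(z^{<t}),a^{<t})\,|\det Dv(z^t)|$ for all $t\in[T]$, $z^{\le t}$ and $a^{<t}\in\mathcal A^t$; - they are $z$-consistent: in addition $\hat G^z=PG^zP^\top$ and $v=c\circ P^\top$ for a diffeomorphism $c$ of $\mathbb R^{d_z}$ that is $G^z$-preserving and $(G^z)^\top$-preserving; - they are equivalent up to quasi-linearity: there are an invertible matrix $L$ and a vector $b$ with $s(v(z))=Ls(z)+b$ for all $z$; - there are $b\in\mathbb R^{d_z}$ and an invertible matrix $C\in\mathbb R^{d_z\times d_z}$, both $G^z$-preserving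 and $(G^z)^\top$-preserving, such that for all $z\in\mathbb R^{d_z}$ the point $CP^\top s(z)+b$ lies in $s(\mathbb R^{d_z})$ and $v(z)=s^{-1}(CP^\top s(z)+b)$. -/

import Mathlib

open MeasureTheory ProbabilityTheory
open scoped NNReal

namespace MechSparse

noncomputable section

/-! ## Vectors, matrices, diffeomorphisms -/

/-- `ℝᵈ`. -/
abbrev Vec (d : ℕ) : Type := Fin d → ℝ

/-- A matrix with entries in `{0, 1}`. -/
def IsBinary {m n : ℕ} (G : Matrix (Fin m) (Fin n) ℝ) : Prop :=
  ∀ i j, G i j = 0 ∨ G i j = 1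

/-- `M ⊆ N`, where a matrix stands for the set of positions of its nonzero entries. -/
def SupportSubset {m n : ℕ} (M N : Matrix (Fin m) (Fin n) ℝ) : Prop :=
  ∀ i j, M i j ≠ 0 → N i j ≠ 0

/-- `‖M‖₀`, the number of nonzero entries. -/
def l0 {m n : ℕ} (M : Matrix (Fin m) (Fin n) ℝ) : ℕ :=
  {q : Fin m × Fin n | M q.1 q.2 ≠ 0}.ncard

/-- `P` is a permutation matrix. -/
def IsPermMatrix {n : ℕ} (P : Matrix (Fin n) (Fin n) ℝ) : Prop :=
  ∃ π : Equiv.Perm (Fin n), P = π.permMatrix ℝ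

/-- The aligned subspace `ℝ^{m×n}_B` of the matrices that vanish wherever `B` does. -/
def alignedSubspace {m n : ℕ} (B : Matrix (Fin m) (Fin n) ℝ) :
    Submodule ℝ (Matrix (Fin m) (Fin n) ℝ) where
  carrier := {M | ∀ i j, B i j = 0 → M i j = 0}
  add_mem' := by
    intro M N hM hN i j h
    simp [hM i j h, hN i j h]
  zero_mem' := by
    intro i j _
    rfl
  smul_mem' := by
    intro c M hM i j h
    simp [hM i j h]

/-- The matrix `C` is `G`-preserving: `Cᵀ ℝ^{m×n}_G ⊆ ℝ^{m×n}_G`. -/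
def PreservingMatrix {m n : ℕ} (G : Matrix (Fin m) (Fin n) ℝ) (C : Matrix (Fin m) (Fin m) ℝ) :
    Prop :=
  ∀ M ∈ alignedSubspace G, C.transpose * M ∈ alignedSubspace G

open Classical in
/-- The functional dependency graph of `h : ℝⁿ → ℝᵐ`: its entry `(i, j)` is `0` exactly when
`hᵢ` is a function of the coordinates other than the `j`-th one. -/
def depGraph {n m : ℕ} (h : Vec n → Vec m) : Matrix (Fin m) (Fin n) ℝ :=
  fun i j =>
    if ∃ g : ({k : Fin n // k ≠ j} → ℝ) → ℝ, ∀ a : Vec n, h a i = g (fun k => a k) then 0 else 1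

/-- The function `c` is `G`-preserving: its dependency graph is. -/
def PreservingMap {m n : ℕ} (G : Matrix (Fin m) (Fin n) ℝ) (c : Vec m → Vec m) : Prop :=
  PreservingMatrix G (depGraph c)

/-- `h : ℝⁿ → ℝᵐ` is a diffeomorphism onto its image: it is `C¹`, and it has an inverse on its image
that is the restriction of a `C¹` map defined on an open set containing the image. -/
def IsDiffeoOntoImage {n m : ℕ} (h : Vec n → Vec m) : Prop :=
  ContDiff ℝ 1 h ∧
    ∃ (U : Set (Vec m)) (g : Vec m → Vec n),
      IsOpen U ∧ Set.range h ⊆ U ∧ ContDiffOn ℝ 1 g U ∧ ∀ z, g (h z) = z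

/-- A diffeomorphism from `ℝⁿ` to itself. -/
def IsDiffeo {n : ℕ} (h : Vec n → Vec n) : Prop :=
  IsDiffeoOntoImage h ∧ Function.Surjective h

/-- The Jacobian matrix `Dh(x)`. -/
def jacobian {n m : ℕ} (h : Vec n → Vec m) (x : Vec n) : Matrix (Fin m) (Fin n) ℝ :=
  LinearMap.toMatrix' (fderiv ℝ h x : Vec n →ₗ[ℝ] Vec m)

/-- The entanglement map `f⁻¹ ∘ f'` of two injective maps with the same image. -/
def entanglementMap {n m : ℕ} (f f' : Vec n → Vec m) : Vec n → Vec n :=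
  fun z => Function.invFun f (f' z)

/-! ## The latent variable model

Time is indexed from `0`: the element `t : Fin T` is the `(t+1)`-st time step. The latent variables
before it are `z^1, …, z^t` (`t` vectors), and the auxiliary variables that may influence it are
`a^0, …, a^t` (`t + 1` vectors). -/

/-- Values of the latent history `z^{<t}`. -/
abbrev LatentPast (dz : ℕ) {T : ℕ} (t : Fin T) : Type := Fin (t : ℕ) → Vec dz

/-- Values of the auxiliary history `a^{<t}`. -/
abbrev AuxPast (da : ℕ) {T : ℕ} (t : Fin T) : Type := Fin ((t : ℕ) + 1) → Vec da

/-- The part of a latent trajectory strictly before step `t`. -/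
def latentPast {dz T : ℕ} (z : Fin T → Vec dz) (t : Fin T) : LatentPast dz t :=
  fun τ => z (Fin.castLE t.isLt.le τ)

/-- The part of an auxiliary sequence that precedes `z^t`. -/
def auxPast {da T : ℕ} (a : Fin T → Vec da) (t : Fin T) : AuxPast da t :=
  fun τ => a (Fin.castLE t.isLt τ)

/-- A model `(f, p, G)` with `G = [Gᶻ, Gᵃ]`: a decoder, mechanisms and two binary graphs.
The number `mech t i x zs as` is the conditional density `p(zᵢᵗ = x ∣ z^{<t} = zs, a^{<t} = as)`. -/
structure LatentModel (dz dx da T : ℕ) where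
  f : Vec dz → Vec dx
  mech : (t : Fin T) → Fin dz → ℝ → LatentPast dz t → AuxPast da t → ℝ
  Gz : Matrix (Fin dz) (Fin dz) ℝ
  Ga : Matrix (Fin dz) (Fin da) ℝ
  Gz_binary : IsBinary Gz
  Ga_binary : IsBinary Ga

variable {dz dx da T : ℕ}

/-- The transition density `p(zᵗ ∣ z^{<t}, a^{<t}) = ∏ᵢ p(zᵢᵗ ∣ z^{<t}, a^{<t})`: the coordinates are
conditionally independent given the past. -/
def LatentModel.transition (θ : LatentModel dz dx da T) (t : Fin T) (z : Vec dz)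
    (zs : LatentPast dz t) (as : AuxPast da t) : ℝ :=
  ∏ i, θ.mech t i (z i) zs as

/-- The conditional law of the latent trajectory given the auxiliary sequence `a`, with density
`∏ₜ p(zᵗ ∣ z^{<t}, a^{<t})` with respect to the Lebesgue measure. -/
def LatentModel.latentLaw (θ : LatentModel dz dx da T) (a : Fin T → Vec da) :
    Measure (Fin T → Vec dz) :=
  volume.withDensity fun z =>
    ENNReal.ofReal (∏ t, θ.transition t (z t) (latentPast z t) (auxPast a t))

/-- The law of the noise: `T` independent `N(0, σ² I)` vectors (the Dirac mass at `0` if `σ² = 0`). -/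
def noiseLaw (dx T : ℕ) (σsq : ℝ≥0) : Measure (Fin T → Vec dx) :=
  Measure.pi fun _ => Measure.pi fun _ => gaussianReal 0 σsq

/-- The conditional law of the observations `xᵗ = f(zᵗ) + nᵗ` given the auxiliary sequence `a`. -/
def LatentModel.obsLaw (θ : LatentModel dz dx da T) (σsq : ℝ≥0) (a : Fin T → Vec da) :
    Measure (Fin T → Vec dx) :=
  ((θ.latentLaw a).prod (noiseLaw dx T σsq)).map fun q => fun t => θ.f (q.1 t) + q.2 t

/-! ## Assumptions on a model -/

/-- The decoder is a diffeomorphism onto its image, the image is closed, and `dz ≤ dx`. (The form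
`xᵗ = f(zᵗ) + nᵗ` of the observations is built into `LatentModel.obsLaw`.) -/
def ObservationModel (θ : LatentModel dz dx da T) : Prop :=
  dz ≤ dx ∧ IsDiffeoOntoImage θ.f ∧ IsClosed (Set.range θ.f)

/-- Each mechanism is a probability density on `ℝ` with support `ℝ`, for every past. (The
factorization of the transition density is built into `LatentModel.transition`.) -/
def CondIndependentLatents (A : Set (Vec da)) (θ : LatentModel dz dx da T) : Prop :=
  ∀ (t : Fin T) (i : Fin dz) (zs : LatentPast dz t) (as : AuxPast da t), (∀ τ, as τ ∈ A) →
    Measurable (fun x => θ.mech t i x zs as) ∧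
    (∀ x, 0 ≤ θ.mech t i x zs as) ∧
    ∫⁻ x, ENNReal.ofReal (θ.mech t i x zs as) = 1 ∧
    tsupport (fun x => θ.mech t i x zs as) = Set.univ

/-- The transition model is Markov with respect to the graphs: the `i`-th mechanism is a function of
the past values of the parents of `i` only. -/
def MarkovWrtGraph (A : Set (Vec da)) (θ : LatentModel dz dx da T) : Prop :=
  ∀ (t : Fin T) (i : Fin dz) (zs zs' : LatentPast dz t) (as as' : AuxPast da t),
    (∀ τ, as τ ∈ A) → (∀ τ, as' τ ∈ A) →
    (∀ τ j, θ.Gz i j = 1 → zs τ j = zs' τ j) →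
    (∀ τ l, θ.Ga i l = 1 → as τ l = as' τ l) →
    ∀ x, θ.mech t i x zs as = θ.mech t i x zs' as'

/-- For every auxiliary history, the mechanisms are `C²` functions of `(zᵢᵗ, z^{<t})`. -/
def SmoothTransitions (A : Set (Vec da)) (θ : LatentModel dz dx da T) : Prop :=
  ∀ (t : Fin T) (i : Fin dz) (as : AuxPast da t), (∀ τ, as τ ∈ A) →
    ContDiff ℝ 2 fun q : ℝ × LatentPast dz t => θ.mech t i q.1 q.2 as

/-- Natural parameters `λ(z^{<t}, a^{<t}) ∈ ℝ^{dz}` (one per coordinate, `k = 1`). -/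
abbrev NaturalParam (dz da T : ℕ) : Type :=
  (t : Fin T) → LatentPast dz t → AuxPast da t → Vec dz

/-- The mechanisms form an exponential family with one-dimensional sufficient statistics `sᵢ`, base
measures `hᵢ` and natural parameters `lamᵢ`; `ψᵢ` is the normalization constant. -/
def ExponentialFamily (A : Set (Vec da)) (s h : Fin dz → ℝ → ℝ) (lam : NaturalParam dz da T)
    (θ : LatentModel dz dx da T) : Prop :=
  ∃ ψ : NaturalParam dz da T,
    ∀ (t : Fin T) (i : Fin dz) (x : ℝ) (zs : LatentPast dz t) (as : AuxPast da t),
      (∀ τ, as τ ∈ A) →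
      θ.mech t i x zs as = h i x * Real.exp (s i x * lam t zs as i - ψ t zs as i)

/-- The element-wise map `s(z) = (s₁(z₁), …, s_{dz}(z_{dz}))`. -/
def statMap (s : Fin dz → ℝ → ℝ) : Vec dz → Vec dz :=
  fun z i => s i (z i)

/-- A one-dimensional sufficient statistic is minimal: no nonzero multiple of it is constant. -/
def MinimalStatistic (s : ℝ → ℝ) : Prop :=
  ¬ ∃ v : ℝ, v ≠ 0 ∧ ∃ c : ℝ, ∀ x, v * s x = c

/-- Sufficient variability: there are `dz + 1` histories, possibly from different time steps, such
that the vectors `λ(z₍ᵣ₎, a₍ᵣ₎) - λ(z₍₀₎, a₍₀₎)`, `r = 1, …, dz`, are linearly independent. -/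
def SufficientVariability (A : Set (Vec da)) (lam : NaturalParam dz da T) : Prop :=
  ∃ (t : Fin (dz + 1) → Fin T) (zs : (r : Fin (dz + 1)) → LatentPast dz (t r))
    (as : (r : Fin (dz + 1)) → AuxPast da (t r)),
    (∀ r τ, as r τ ∈ A) ∧
    LinearIndependent ℝ fun r : Fin dz =>
      lam (t r.succ) (zs r.succ) (as r.succ) - lam (t 0) (zs 0) (as 0)

/-- The Jacobian matrix of `λ(z^{<t}, a^{<t})` with respect to `z^τ`. -/
def jacobianAt (lam : NaturalParam dz da T) (t : Fin T) (τ : Fin (t : ℕ)) (zs : LatentPast dz t)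
    (as : AuxPast da t) : Matrix (Fin dz) (Fin dz) ℝ :=
  jacobian (fun w => lam t (Function.update zs τ w) as) (zs τ)

/-- Sufficient influence of `z`: `Ds` is invertible everywhere, and there are `‖G‖₀` histories (with
time steps `τ` in them) for which the matrices `D^τ λ · Ds(z^τ)⁻¹` span `ℝ^{dz×dz}_G`. -/
def SufficientInfluence (A : Set (Vec da)) (s : Fin dz → ℝ → ℝ) (lam : NaturalParam dz da T)
    (G : Matrix (Fin dz) (Fin dz) ℝ) : Prop :=
  (∀ z, IsUnit (jacobian (statMap s) z)) ∧
  ∃ (t : Fin (l0 G) → Fin T) (τ : (r : Fin (l0 G)) → Fin (t r : ℕ))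
    (zs : (r : Fin (l0 G)) → LatentPast dz (t r)) (as : (r : Fin (l0 G)) → AuxPast da (t r)),
    (∀ r ρ, as r ρ ∈ A) ∧
    Submodule.span ℝ (Set.range fun r =>
      jacobianAt lam (t r) (τ r) (zs r) (as r) * (jacobian (statMap s) (zs r (τ r)))⁻¹) =
      alignedSubspace G

/-! ## Equivalence relations between models -/

/-- Observational equivalence: the same conditional law of the observations, for every value of the
auxiliary variables. -/
def ObsEquiv (A : Set (Vec da)) (σsq : ℝ≥0) (θ θ' : LatentModel dz dx da T) : Prop :=
  ∀ a : Fin T → Vec da, (∀ t, a t ∈ A) → θ.obsLaw σsq a = θ'.obsLaw σsq a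

/-- Equivalence up to diffeomorphism. -/
def DiffEquiv (A : Set (Vec da)) (θ θ' : LatentModel dz dx da T) : Prop :=
  Set.range θ.f = Set.range θ'.f ∧
  IsDiffeo (entanglementMap θ.f θ'.f) ∧
  ∀ (t : Fin T) (z : Vec dz) (zs : LatentPast dz t) (as : AuxPast da t), (∀ τ, as τ ∈ A) →
    θ'.transition t z zs as =
      θ.transition t (entanglementMap θ.f θ'.f z)
        (fun τ => entanglementMap θ.f θ'.f (zs τ)) as *
        |(jacobian (entanglementMap θ.f θ'.f) z).det|

/-- `z`-consistency with a given permutation matrix `P`. -/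
def ZConsistentWith (A : Set (Vec da)) (P : Matrix (Fin dz) (Fin dz) ℝ)
    (θ θ' : LatentModel dz dx da T) : Prop :=
  DiffEquiv A θ θ' ∧ θ'.Gz = P * θ.Gz * P.transpose ∧
  ∃ c : Vec dz → Vec dz, IsDiffeo c ∧ PreservingMap θ.Gz c ∧ PreservingMap θ.Gz.transpose c ∧
    ∀ z, entanglementMap θ.f θ'.f z = c (P.transpose.mulVec z)

/-- Equivalence up to quasi-linearity (for `k = 1`). -/
def QuasiLinearEquiv (A : Set (Vec da)) (s : Fin dz → ℝ → ℝ) (θ θ' : LatentModel dz dx da T) :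
    Prop :=
  DiffEquiv A θ θ' ∧
  ∃ (L : Matrix (Fin dz) (Fin dz) ℝ) (b : Vec dz), IsUnit L ∧
    ∀ z, statMap s (entanglementMap θ.f θ'.f z) = L.mulVec (statMap s z) + b

end

end MechSparse

open MechSparse

namespace MechSparse

/-! ## Sparsity patterns of matrices -/

/-! Gaussian noise has a nowhere vanishing characteristic function, so equality of the observation
laws passes to the noiseless laws (`conv_right_cancel`). Closed images and latent densities positive
on a dense set then force the two decoders to have the same image, so `v = f⁻¹ ∘ f'` is a
diffeomorphism carrying one latent law to the other. The change of variables formula relates the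
trajectory densities; integrating out later times splits this into one identity per transition
(`diffEquiv_of_obsEquiv`).

In exponential form, the ratio of transition densities at two histories cancels both base measures
and the Jacobian determinant. What remains says that `s(v(z)) · Δλ` and `s(z) · Δλ'` differ by a
constant. Inverting the matrix of `dz` independent differences `Δλ` gives `s(v(z)) = L s(z) + b`
(`exists_statMap_eq_mulVec_add`); minimality of `s` then gives `Δλ' = Lᵀ Δλ`
(`naturalParam_sub_eq`).

Differentiating both relations shows that `Lᵀ (Dλ Ds⁻¹) L = Dλ' Ds⁻¹`, with the left factor
evaluated at the transported history. The right side vanishes off the learned graph `G'` by the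
Markov property. The matrices `Dλ Ds⁻¹` span `ℝ_G`, so `Lᵀ ℝ_G L ⊆ ℝ_{G'}`. Testing this on matrix
units gives the combinatorial rule that drives everything: `G i j`, `L i k`, `L j l` nonzero imply
`G' k l` nonzero (`edge_of_conj_mem_alignedSubspace`).

An invertible `L` has a permutation `σ` with all `L (σ k) k ≠ 0`, and the rule gives `P G Pᵀ ⊆ G'`.
The sparsity bound turns this into equality, after which the rule says that the support of `C = L P`
maps edges of `G` to edges of `G`. As `C` has nonzero diagonal, it preserves `G` and `Gᵀ`, and so
does `c = v ∘ P`, whose dependencies lie in the support of `C`. -/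

theorem exists_perm_forall_ne_zero {n : ℕ} {L : Matrix (Fin n) (Fin n) ℝ} (hL : IsUnit L) :
    ∃ σ : Equiv.Perm (Fin n), ∀ k, L (σ k) k ≠ 0 := by
  by_contra! hcon
  have hdet : L.det ≠ 0 := ((Matrix.isUnit_iff_isUnit_det L).1 hL).ne_zero
  refine hdet ?_
  -- If every permutation met a zero entry, every term of the Leibniz expansion would vanish.
  rw [Matrix.det_apply]
  refine Finset.sum_eq_zero fun σ _ => ?_
  obtain ⟨k, hk⟩ := hcon σ
  have h0 : ∏ i, L (σ i) i = 0 :=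
    Finset.prod_eq_zero (f := fun i => L (σ i) i) (Finset.mem_univ k) hk
  exact (congrArg (fun x => Equiv.Perm.sign σ • x) h0).trans (smul_zero _)

theorem permMatrix_apply {n : ℕ} (σ : Equiv.Perm (Fin n)) (i j : Fin n) :
    σ.permMatrix ℝ i j = if σ i = j then 1 else 0 := by
  simp [Equiv.Perm.permMatrix, PEquiv.toMatrix_apply, Equiv.toPEquiv_apply, eq_comm]

theorem permMatrix_conj_apply {n : ℕ} (σ : Equiv.Perm (Fin n)) (G : Matrix (Fin n) (Fin n) ℝ)
    (k l : Fin n) :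
    (σ.permMatrix ℝ * G * (σ.permMatrix ℝ).transpose) k l = G (σ k) (σ l) := by
  simp only [Matrix.mul_apply, Matrix.transpose_apply, permMatrix_apply, ite_mul, one_mul, zero_mul,
    mul_ite, mul_one, mul_zero, Finset.sum_ite_eq, Finset.mem_univ, if_true]

theorem permMatrix_mul_transpose_self {n : ℕ} (σ : Equiv.Perm (Fin n)) :
    σ.permMatrix ℝ * (σ.permMatrix ℝ).transpose = 1 := by
  ext i j
  simp only [Matrix.mul_apply, Matrix.transpose_apply, permMatrix_apply, ite_mul, one_mul, zero_mul,
    Finset.sum_ite_eq, Finset.mem_univ, if_true, Matrix.one_apply, σ.injective.eq_iff]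
  exact if_congr eq_comm rfl rfl

theorem transpose_permMatrix_mul_self {n : ℕ} (σ : Equiv.Perm (Fin n)) :
    (σ.permMatrix ℝ).transpose * σ.permMatrix ℝ = 1 :=
  mul_eq_one_comm.1 (permMatrix_mul_transpose_self σ)

theorem mul_permMatrix_apply {n : ℕ} (σ : Equiv.Perm (Fin n)) (L : Matrix (Fin n) (Fin n) ℝ)
    (i k : Fin n) : (L * σ.permMatrix ℝ) i (σ k) = L i k := by
  simp only [Matrix.mul_apply, permMatrix_apply, σ.injective.eq_iff, mul_ite, mul_one, mul_zero,
    Finset.sum_ite_eq', Finset.mem_univ, if_true]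

/-- If `Lᵀ ℝ_G L ⊆ ℝ_{G'}`, then products of entries of `L` propagate edges of `G` to `G'`. -/
theorem edge_of_conj_mem_alignedSubspace {n : ℕ} {G G' L : Matrix (Fin n) (Fin n) ℝ}
    (h : ∀ M ∈ alignedSubspace G, L.transpose * M * L ∈ alignedSubspace G') {i j k l : Fin n}
    (hij : G i j ≠ 0) (hik : L i k ≠ 0) (hjl : L j l ≠ 0) : G' k l ≠ 0 := by
  intro h0
  -- The matrix unit `E` at `(i, j)` is aligned with `G`, and the `(k, l)` entry of `Lᵀ E L` is `L i
  -- k * L j l`.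
  have hM : Matrix.single i j (1 : ℝ) ∈ alignedSubspace G := by
    intro a b hab
    rw [Matrix.single_apply]
    split_ifs with hc
    · exact absurd (by rw [hc.1, hc.2]; exact hab) hij
    · rfl
  have := h _ hM k l h0
  simp [Matrix.mul_apply, Matrix.single_apply, Finset.sum_ite_eq, ite_and, hik, hjl] at this

theorem l0_permMatrix_conj {n : ℕ} (σ : Equiv.Perm (Fin n)) (G : Matrix (Fin n) (Fin n) ℝ) :
    l0 (σ.permMatrix ℝ * G * (σ.permMatrix ℝ).transpose) = l0 G := by
  unfold l0
  simp only [permMatrix_conj_apply]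
  exact Set.ncard_congr' ((σ.prodCongr σ).subtypeEquiv fun q => by simp)

theorem IsBinary.permMatrix_conj {n : ℕ} {G : Matrix (Fin n) (Fin n) ℝ} (hG : IsBinary G)
    (σ : Equiv.Perm (Fin n)) :
    IsBinary (σ.permMatrix ℝ * G * (σ.permMatrix ℝ).transpose) := by
  intro i j
  rw [permMatrix_conj_apply]
  exact hG _ _

theorem eq_of_supportSubset_of_l0_le {m n : ℕ} {M N : Matrix (Fin m) (Fin n) ℝ}
    (hM : IsBinary M) (hN : IsBinary N) (hMN : SupportSubset M N) (hle : l0 N ≤ l0 M) :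
    M = N := by
  have hset : {q : Fin m × Fin n | M q.1 q.2 ≠ 0} = {q | N q.1 q.2 ≠ 0} :=
    Set.eq_of_subset_of_ncard_le (fun q hq => hMN _ _ hq) hle (Set.toFinite _)
  ext i j
  have hiff : M i j ≠ 0 ↔ N i j ≠ 0 := Set.ext_iff.1 hset (i, j)
  rcases hM i j with h | h <;> rcases hN i j with h' | h' <;> simp_all

/-- A nonzero term `D i k * M i l` of `Dᵀ M` at `(k, l)` gives an edge `G i l`; moving its first end
along `C i k` and keeping its second end fixed, via `C l l ≠ 0`, gives `G k l ≠ 0`. Allowing `D`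
inside the support of `C` covers both the matrix `C` itself and the dependency graph of `c`. -/
theorem preservingMatrix_of_support {n : ℕ} {G C D : Matrix (Fin n) (Fin n) ℝ}
    (hC : ∀ i j k l, G i j ≠ 0 → C i k ≠ 0 → C j l ≠ 0 → G k l ≠ 0)
    (hdiag : ∀ k, C k k ≠ 0) (hD : ∀ i k, D i k ≠ 0 → C i k ≠ 0) : PreservingMatrix G D := by
  intro M hM k l hkl
  rw [Matrix.mul_apply]
  refine Finset.sum_eq_zero fun i _ => ?_
  by_contra hne
  have h1 := left_ne_zero_of_mul hne
  have h2 := right_ne_zero_of_mul hne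
  exact hC i l k l (fun h0 => h2 (hM i l h0)) (hD i k h1) (hdiag l) hkl

theorem preservingMatrix_transpose_of_support {n : ℕ} {G C D : Matrix (Fin n) (Fin n) ℝ}
    (hC : ∀ i j k l, G i j ≠ 0 → C i k ≠ 0 → C j l ≠ 0 → G k l ≠ 0)
    (hdiag : ∀ k, C k k ≠ 0) (hD : ∀ i k, D i k ≠ 0 → C i k ≠ 0) :
    PreservingMatrix G.transpose D :=
  preservingMatrix_of_support (fun i j k l hij hik hjl => hC j i l k hij hjl hik) hdiag hD

/-! ## Removing the noise -/

/-- Characteristic functions turn convolution into multiplication, and a nowhere zero factor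
cancels. -/
theorem conv_right_cancel {E : Type*} [NormedAddCommGroup E] [NormedSpace ℝ E] [CompleteSpace E]
    [MeasurableSpace E] [BorelSpace E] [SecondCountableTopology E] {μ ν ρ : Measure E}
    [IsFiniteMeasure μ] [IsFiniteMeasure ν] [IsFiniteMeasure ρ]
    (hρ : ∀ L : StrongDual ℝ E, charFunDual ρ L ≠ 0) (h : μ.conv ρ = ν.conv ρ) : μ = ν := by
  refine Measure.ext_of_charFunDual (funext fun L => mul_right_cancel₀ (hρ L) ?_)
  rw [← charFunDual_conv, ← charFunDual_conv, h]

theorem charFunDual_noiseLaw_ne_zero (dx T : ℕ) (σsq : ℝ≥0)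
    (L : StrongDual ℝ (Fin T → Vec dx)) : charFunDual (noiseLaw dx T σsq) L ≠ 0 := by
  unfold noiseLaw
  rw [charFunDual_pi]
  refine Finset.prod_ne_zero_iff.2 fun t _ => ?_
  rw [charFunDual_pi]
  refine Finset.prod_ne_zero_iff.2 fun i _ => ?_
  rw [IsGaussian.charFunDual_eq]
  exact Complex.exp_ne_zero _

instance isProbabilityMeasure_noiseLaw (dx T : ℕ) (σsq : ℝ≥0) :
    IsProbabilityMeasure (noiseLaw dx T σsq) := by
  unfold noiseLaw
  infer_instance

theorem LatentModel.obsLaw_eq_conv {dz dx da T : ℕ} (θ : LatentModel dz dx da T) (σsq : ℝ≥0)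
    (a : Fin T → Vec da) (hf : Measurable θ.f) [SFinite (θ.latentLaw a)] :
    θ.obsLaw σsq a =
      ((θ.latentLaw a).map fun z t => θ.f (z t)).conv (noiseLaw dx T σsq) := by
  have hF : Measurable fun (z : Fin T → Vec dz) t => θ.f (z t) := by fun_prop
  unfold LatentModel.obsLaw Measure.conv
  conv_rhs => rw [← Measure.map_id (μ := noiseLaw dx T σsq)]
  rw [Measure.map_prod_map _ _ hF measurable_id, Measure.map_map (by fun_prop) (by fun_prop)]
  rfl

/-! ## Marginals of a causal product of densities -/

/-- If `p t` depends on the coordinates up to `t` only and is a probability density in the `t`-th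
one, then integrating out the coordinates from `k` on leaves the product of the first `k`
factors. -/
theorem lmarginal_prod_causal {T : ℕ} {E : Type*} [MeasurableSpace E] (ν : Measure E)
    [SigmaFinite ν] (p : Fin T → (Fin T → E) → ENNReal) (hp : ∀ t, Measurable (p t))
    (hdep : ∀ t z z', (∀ s ≤ t, z s = z' s) → p t z = p t z')
    (hint : ∀ t z, ∫⁻ w, p t (Function.update z t w) ∂ν = 1) {k : ℕ} (hk : k ≤ T)
    (z : Fin T → E) :
    lmarginal (fun _ => ν) {t : Fin T | k ≤ (t : ℕ)} (fun z => ∏ t, p t z) z =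
      ∏ t ∈ ({t | (t : ℕ) < k} : Finset (Fin T)), p t z := by
  -- Downward from `k = T`, where nothing is integrated: passing from `k + 1` to `k` integrates out
  -- coordinate `k`, which among the remaining factors only the `k`-th one sees.
  induction hk using Nat.decreasingInduction generalizing z with
  | self =>
    have h1 : ({t : Fin T | T ≤ (t : ℕ)} : Finset (Fin T)) = ∅ :=
      Finset.filter_eq_empty_iff.2 fun t _ => by simp
    have h2 : ({t : Fin T | (t : ℕ) < T} : Finset (Fin T)) = Finset.univ :=
      Finset.filter_true_of_mem fun t _ => t.isLt
    rw [h1, h2, lmarginal_empty]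
  | of_succ k hk ih =>
    have hk' : k < T := hk
    have h1 : ({t : Fin T | k ≤ (t : ℕ)} : Finset (Fin T)) =
        insert ⟨k, hk'⟩ ({t : Fin T | k + 1 ≤ (t : ℕ)} : Finset (Fin T)) := by
      ext t
      simp [Fin.ext_iff]
      lia
    have h2 : ({t : Fin T | (t : ℕ) < k + 1} : Finset (Fin T)) =
        insert ⟨k, hk'⟩ ({t : Fin T | (t : ℕ) < k} : Finset (Fin T)) := by
      ext t
      simp [Fin.ext_iff]
      lia
    have hmeas : Measurable fun z => ∏ t, p t z := Finset.measurable_prod _ fun t _ => hp t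
    rw [h1, lmarginal_insert _ hmeas (by simp)]
    simp only [ih]
    rw [h2]
    have hconst : ∀ w, ∏ t ∈ insert ⟨k, hk'⟩ ({t : Fin T | (t : ℕ) < k} : Finset (Fin T)),
        p t (Function.update z ⟨k, hk'⟩ w) =
        p ⟨k, hk'⟩ (Function.update z ⟨k, hk'⟩ w) *
          ∏ t ∈ ({t | (t : ℕ) < k} : Finset (Fin T)), p t z := by
      intro w
      rw [Finset.prod_insert (by simp)]
      congr 1
      refine Finset.prod_congr rfl fun t ht => hdep t _ _ fun s hs => ?_
      refine Function.update_of_ne (fun h => ?_) _ _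
      have h3 : (t : ℕ) < k := by simpa using ht
      have h4 : (s : ℕ) ≤ t := hs
      have h5 : (s : ℕ) = k := by rw [h]
      lia
    simp only [hconst]
    have hm : Measurable fun w => p ⟨k, hk'⟩ (Function.update z ⟨k, hk'⟩ w) :=
      (hp _).comp (measurable_update z)
    rw [lintegral_mul_const _ hm, hint, one_mul]

theorem lintegral_prod_causal {T : ℕ} {E : Type*} [MeasurableSpace E] [Nonempty E]
    (ν : Measure E) [SigmaFinite ν] (p : Fin T → (Fin T → E) → ENNReal)
    (hp : ∀ t, Measurable (p t)) (hdep : ∀ t z z', (∀ s ≤ t, z s = z' s) → p t z = p t z')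
    (hint : ∀ t z, ∫⁻ w, p t (Function.update z t w) ∂ν = 1) :
    ∫⁻ z, ∏ t, p t z ∂(Measure.pi fun _ => ν) = 1 := by
  have h := lmarginal_prod_causal ν p hp hdep hint (Nat.zero_le T) (fun _ => Classical.arbitrary E)
  rw [lintegral_eq_lmarginal_univ (fun _ => Classical.arbitrary E)]
  simpa using h

/-- Marginalizing equal products makes all partial products agree, and consecutive ones differ by
one factor. The common prefix is kept as a multiplier because it may vanish. -/
theorem causal_factors_mul_eq {T : ℕ} {E : Type*} [MeasurableSpace E] (ν : Measure E)
    [SigmaFinite ν] (p q : Fin T → (Fin T → E) → ENNReal) (hp : ∀ t, Measurable (p t))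
    (hq : ∀ t, Measurable (q t))
    (hpdep : ∀ t z z', (∀ s ≤ t, z s = z' s) → p t z = p t z')
    (hqdep : ∀ t z z', (∀ s ≤ t, z s = z' s) → q t z = q t z')
    (hpint : ∀ t z, ∫⁻ w, p t (Function.update z t w) ∂ν = 1)
    (hqint : ∀ t z, ∫⁻ w, q t (Function.update z t w) ∂ν = 1)
    (h : ∀ z, ∏ t, p t z = ∏ t, q t z) (k : Fin T) (z : Fin T → E) :
    (∏ t with t < k, p t z) * p k z = (∏ t with t < k, p t z) * q k z := by
  have key : ∀ m ≤ T, ∏ t ∈ ({t | (t : ℕ) < m} : Finset (Fin T)), p t z =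
      ∏ t ∈ ({t | (t : ℕ) < m} : Finset (Fin T)), q t z := by
    intro m hm
    rw [← lmarginal_prod_causal ν p hp hpdep hpint hm,
      ← lmarginal_prod_causal ν q hq hqdep hqint hm,
      funext h]
  have hins : ({t : Fin T | (t : ℕ) < (k : ℕ) + 1} : Finset (Fin T)) =
      insert k ({t : Fin T | t < k} : Finset (Fin T)) := by
    ext t
    simp [Fin.ext_iff, ← Fin.val_fin_lt]
    lia
  have h0 : ∏ t with t < k, p t z = ∏ t with t < k, q t z := key k k.isLt.le
  have h1 := key (k + 1) k.isLt
  rw [hins, Finset.prod_insert (by simp), Finset.prod_insert (by simp)] at h1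
  rw [mul_comm, h1, ← h0, mul_comm]

/-! ## Diffeomorphisms and the entanglement map -/

theorem IsDiffeoOntoImage.injective {n m : ℕ} {h : Vec n → Vec m} (hh : IsDiffeoOntoImage h) :
    Function.Injective h := by
  obtain ⟨-, U, g, -, -, -, hg⟩ := hh
  exact Function.LeftInverse.injective hg

theorem apply_entanglementMap {n m : ℕ} {f f' : Vec n → Vec m}
    (hr : Set.range f' ⊆ Set.range f) (z : Vec n) : f (entanglementMap f f' z) = f' z :=
  Function.invFun_eq (hr ⟨z, rfl⟩)

/-- On the common image `f⁻¹` is the restriction of a `C¹` map `g` on an open set, so the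
entanglement map is `g ∘ f'`. -/
theorem contDiff_entanglementMap {n m : ℕ} {f f' : Vec n → Vec m} (hf : IsDiffeoOntoImage f)
    (hf' : ContDiff ℝ 1 f') (hr : Set.range f' ⊆ Set.range f) :
    ContDiff ℝ 1 (entanglementMap f f') := by
  obtain ⟨-, U, g, hU, hfU, hg, hgf⟩ := hf
  have heq : entanglementMap f f' = g ∘ f' := by
    funext z
    rw [Function.comp_apply, ← apply_entanglementMap hr z, hgf]
  rw [heq]
  refine contDiff_iff_contDiffAt.2 fun z => ?_
  exact (hg.contDiffAt (hU.mem_nhds (hfU (hr ⟨z, rfl⟩)))).comp z hf'.contDiffAt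

theorem entanglementMap_leftInverse {n m : ℕ} {f f' : Vec n → Vec m}
    (hf' : Function.Injective f') (hr : Set.range f' = Set.range f) (z : Vec n) :
    entanglementMap f' f (entanglementMap f f' z) = z :=
  hf' (by rw [apply_entanglementMap hr.ge, apply_entanglementMap hr.le])

theorem isDiffeo_of_inverse {n : ℕ} {v w : Vec n → Vec n} (hv : ContDiff ℝ 1 v)
    (hw : ContDiff ℝ 1 w) (hwv : ∀ z, w (v z) = z) (hvw : ∀ z, v (w z) = z) : IsDiffeo v :=
  ⟨⟨hv, Set.univ, w, isOpen_univ, Set.subset_univ _, hw.contDiffOn, hwv⟩,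
    Function.RightInverse.surjective hvw⟩

theorem isDiffeo_entanglementMap {n m : ℕ} {f f' : Vec n → Vec m} (hf : IsDiffeoOntoImage f)
    (hf' : IsDiffeoOntoImage f') (hr : Set.range f' = Set.range f) :
    IsDiffeo (entanglementMap f f') :=
  isDiffeo_of_inverse (contDiff_entanglementMap hf hf'.1 hr.le)
    (contDiff_entanglementMap hf' hf.1 hr.ge)
    (entanglementMap_leftInverse hf'.injective hr)
    (entanglementMap_leftInverse hf.injective hr.symm)

theorem IsDiffeo.injective {n : ℕ} {v : Vec n → Vec n} (hv : IsDiffeo v) : Function.Injective v :=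
  hv.1.injective

theorem IsDiffeo.hasFDerivAt {n : ℕ} {v : Vec n → Vec n} (hv : IsDiffeo v) (z : Vec n) :
    HasFDerivAt v (fderiv ℝ v z) z :=
  (hv.1.1.differentiable one_ne_zero z).hasFDerivAt

theorem det_jacobian {n : ℕ} (v : Vec n → Vec n) (z : Vec n) :
    (jacobian v z).det = (fderiv ℝ v z).det :=
  LinearMap.det_toMatrix' _

theorem jacobian_comp {l m n : ℕ} {g : Vec m → Vec n} {h : Vec l → Vec m} {x : Vec l}
    (hg : DifferentiableAt ℝ g (h x)) (hh : DifferentiableAt ℝ h x) :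
    jacobian (fun y => g (h y)) x = jacobian g (h x) * jacobian h x := by
  unfold jacobian
  rw [fderiv_fun_comp x hg hh, ContinuousLinearMap.toLinearMap_comp, LinearMap.toMatrix'_comp]

theorem jacobian_mulVec_add {m n : ℕ} (L : Matrix (Fin n) (Fin m) ℝ) (b : Vec n) (x : Vec m) :
    jacobian (fun y => L.mulVec y + b) x = L := by
  have h : HasFDerivAt (fun y => L.mulVec y + b)
      (LinearMap.toContinuousLinearMap (Matrix.toLin' L)) x :=
    ((LinearMap.toContinuousLinearMap (Matrix.toLin' L)).hasFDerivAt).add_const b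
  unfold jacobian
  rw [h.fderiv]
  simp

theorem IsDiffeo.isUnit_jacobian {n : ℕ} {v : Vec n → Vec n} (hv : IsDiffeo v) (z : Vec n) :
    IsUnit (jacobian v z) := by
  have hd := hv.1.1.differentiable one_ne_zero z
  obtain ⟨⟨-, U, g, hU, hvU, hg, hgv⟩, -⟩ := hv
  have hgd : DifferentiableAt ℝ g (v z) :=
    (hg.contDiffAt (hU.mem_nhds (hvU ⟨z, rfl⟩))).differentiableAt one_ne_zero
  have h1 := jacobian_comp hgd hd
  have h2 : jacobian (fun y : Vec n => y) z = 1 := by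
    unfold jacobian
    rw [fderiv_fun_id]
    exact LinearMap.toMatrix'_id
  rw [funext hgv, h2] at h1
  exact IsUnit.of_mul_eq_one _ (mul_eq_one_comm.1 h1.symm)

theorem IsDiffeo.continuous_det_jacobian {n : ℕ} {v : Vec n → Vec n} (hv : IsDiffeo v) :
    Continuous fun z => (jacobian v z).det := by
  simp_rw [det_jacobian]
  exact ContinuousLinearMap.continuous_det.comp (hv.1.1.continuous_fderiv one_ne_zero)

/-! ## Changes of variables -/

theorem IsDiffeo.lintegral_comp {n : ℕ} {v : Vec n → Vec n} (hv : IsDiffeo v)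
    (F : Vec n → ENNReal) :
    ∫⁻ z, F (v z) * ENNReal.ofReal |(jacobian v z).det| = ∫⁻ z, F z := by
  have h := lintegral_image_eq_lintegral_abs_det_fderiv_mul volume MeasurableSet.univ
    (fun z _ => (hv.hasFDerivAt z).hasFDerivWithinAt) hv.injective.injOn F
  rw [Set.image_univ, hv.2.range_eq, Measure.restrict_univ] at h
  rw [h]
  simp_rw [det_jacobian, mul_comm]

/-- The derivative of the coordinatewise map is block diagonal, so its determinant is the product of
those of the blocks. -/
theorem IsDiffeo.setLIntegral_image_pi {n T : ℕ} {v : Vec n → Vec n} (hv : IsDiffeo v)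
    (F : (Fin T → Vec n) → ENNReal) {S : Set (Fin T → Vec n)} (hS : MeasurableSet S) :
    ∫⁻ z in (fun z t => v (z t)) '' S, F z =
      ∫⁻ z in S, F (fun t => v (z t)) * ENNReal.ofReal (∏ t, |(jacobian v (z t)).det|) := by
  have hd : ∀ z : Fin T → Vec n, HasFDerivAt (fun z t => v (z t))
      (ContinuousLinearMap.pi fun t => (fderiv ℝ v (z t)).comp (ContinuousLinearMap.proj t)) z := by
    intro z
    refine hasFDerivAt_pi.2 fun t => ?_
    exact (hv.hasFDerivAt (z t)).comp z (hasFDerivAt_apply t z)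
  have hinj : Set.InjOn (fun (z : Fin T → Vec n) t => v (z t)) S := by
    intro z _ z' _ h
    funext t
    exact hv.injective (congrFun h t)
  rw [lintegral_image_eq_lintegral_abs_det_fderiv_mul volume hS
    (fun z _ => (hd z).hasFDerivWithinAt) hinj]
  simp_rw [ContinuousLinearMap.det_pi, ← det_jacobian, Finset.abs_prod, mul_comm]

/-- If the coordinatewise action of a diffeomorphism transports one continuous density to another,
then the densities are related by the change of variables formula everywhere. -/
theorem IsDiffeo.density_eq {n T : ℕ} {v : Vec n → Vec n} (hv : IsDiffeo v)
    {p p' : (Fin T → Vec n) → ℝ} (hp : Continuous p) (hp' : Continuous p') (hp0 : ∀ z, 0 ≤ p z)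
    (hp0' : ∀ z, 0 ≤ p' z)
    (h : (volume.withDensity fun z => ENNReal.ofReal (p' z)).map (fun z t => v (z t)) =
      volume.withDensity fun z => ENNReal.ofReal (p z)) (z : Fin T → Vec n) :
    p' z = p (fun t => v (z t)) * ∏ t, |(jacobian v (z t)).det| := by
  have hvc : Continuous v := hv.1.1.continuous
  have hVc : Continuous fun (z : Fin T → Vec n) t => v (z t) := by fun_prop
  have hinj : Function.Injective fun (z : Fin T → Vec n) t => v (z t) := by
    intro z z' h
    funext t
    exact hv.injective (congrFun h t)
  have hemb := hVc.measurableEmbedding hinj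
  have hdc := hv.continuous_det_jacobian
  have hq : Continuous fun z : Fin T → Vec n =>
      p (fun t => v (z t)) * ∏ t, |(jacobian v (z t)).det| := by
    refine (hp.comp hVc).mul (continuous_finsetProd _ fun t _ => ?_)
    exact (hdc.comp (continuous_apply t)).abs
  have hq0 : ∀ z : Fin T → Vec n, 0 ≤ p (fun t => v (z t)) * ∏ t, |(jacobian v (z t)).det| :=
    fun z => mul_nonneg (hp0 _) (Finset.prod_nonneg fun t _ => abs_nonneg _)
  -- Both sides have the same integral over every measurable `S`: evaluate the equality of measures
  -- on the image of `S`. Continuity then upgrades almost everywhere to everywhere.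
  have hae : (fun z => ENNReal.ofReal (p' z)) =ᵐ[volume] fun z : Fin T → Vec n =>
      ENNReal.ofReal (p (fun t => v (z t)) * ∏ t, |(jacobian v (z t)).det|) := by
    refine ae_eq_of_forall_setLIntegral_eq_of_sigmaFinite
      (ENNReal.measurable_ofReal.comp hp'.measurable)
      (ENNReal.measurable_ofReal.comp hq.measurable) fun S hS _ => ?_
    have hV := congrArg (fun μ => μ ((fun z t => v (z t)) '' S)) h
    rw [hemb.map_apply, hinj.preimage_image, withDensity_apply _ hS,
      withDensity_apply _ (hemb.measurableSet_image.2 hS), hv.setLIntegral_image_pi _ hS] at hV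
    rw [hV]
    simp_rw [ENNReal.ofReal_mul (hp0 _)]
  have hfun := ((ENNReal.continuous_ofReal.comp hp').ae_eq_iff_eq (μ := volume)
    (ENNReal.continuous_ofReal.comp hq)).1 hae
  exact (ENNReal.ofReal_eq_ofReal_iff (hp0' z) (hq0 z)).1 (congrFun hfun z)

/-- The image of a decoder is determined by the law of the noiseless observations, provided it is
closed and the latent density is positive on a dense set. -/
theorem range_subset_of_map_eq {n m T : ℕ} {f f' : Vec n → Vec m} (hf : Continuous f)
    (hf' : Continuous f') (hcl : IsClosed (Set.range f)) (hT : 0 < T)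
    {p' : (Fin T → Vec n) → ℝ} (hp' : Continuous p') (hdense : Dense {z | 0 < p' z})
    {μ : Measure (Fin T → Vec n)}
    (h : μ.map (fun z t => f (z t)) =
      (volume.withDensity fun z => ENNReal.ofReal (p' z)).map (fun z t => f' (z t))) :
    Set.range f' ⊆ Set.range f := by
  have hFc : Continuous fun (z : Fin T → Vec n) t => f (z t) := by fun_prop
  have hFc' : Continuous fun (z : Fin T → Vec n) t => f' (z t) := by fun_prop
  set S : Set (Fin T → Vec m) := Set.univ.pi fun _ => Set.range f with hSdef
  have hS : IsClosed S := isClosed_set_pi fun _ _ => hcl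
  have hmeas : Measurable fun z => ENNReal.ofReal (p' z) := hp'.measurable.ennreal_ofReal
  -- No trajectory is sent outside `S` by `f`, so the law built from `f'` does not charge `Sᶜ`
  -- either. Its preimage under `f'` is open; if nonempty, it would meet the positivity set of `p'`
  -- in a nonempty open null set.
  have h0 : μ.map (fun z t => f (z t)) Sᶜ = 0 := by
    rw [Measure.map_apply hFc.measurable hS.measurableSet.compl]
    convert measure_empty (μ := μ)
    ext z
    simp [hSdef]
  rw [h, Measure.map_apply hFc'.measurable hS.measurableSet.compl,
    withDensity_apply_eq_zero hmeas] at h0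
  have hO : IsOpen ((fun z t => f' (z t)) ⁻¹' Sᶜ : Set (Fin T → Vec n)) :=
    hS.isOpen_compl.preimage hFc'
  have hpos : {z | ENNReal.ofReal (p' z) ≠ 0} = {z | 0 < p' z} := by
    ext z
    simp
  rw [hpos] at h0
  have hempty := (((isOpen_lt continuous_const hp').inter hO).measure_eq_zero_iff volume).1 h0
  have hO0 : ((fun z t => f' (z t)) ⁻¹' Sᶜ : Set (Fin T → Vec n)) = ∅ := by
    by_contra hne
    obtain ⟨z, hz⟩ := hdense.inter_open_nonempty _ hO (Set.nonempty_iff_ne_empty.2 hne)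
    exact Set.eq_empty_iff_forall_notMem.1 hempty z ⟨hz.2, hz.1⟩
  rintro _ ⟨w, rfl⟩
  -- A constant trajectory reduces the claim to a single point; `0 < T` supplies a coordinate to
  -- read off.
  have hw : (fun _ => w : Fin T → Vec n) ∉
      ((fun z t => f' (z t)) ⁻¹' Sᶜ : Set (Fin T → Vec n)) := by
    rw [hO0]
    exact Set.notMem_empty _
  simp only [Set.mem_preimage, Set.mem_compl_iff, not_not] at hw
  exact hw ⟨0, hT⟩ trivial

/-- Equal laws of the noiseless observations mean that the entanglement map transports one latent
law to the other. -/
theorem map_entanglementMap {n m T : ℕ} {f f' : Vec n → Vec m} (hf : IsDiffeoOntoImage f)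
    (hf' : IsDiffeoOntoImage f') (hr : Set.range f' = Set.range f) {μ μ' : Measure (Fin T → Vec n)}
    (h : μ.map (fun z t => f (z t)) = μ'.map (fun z t => f' (z t))) :
    μ'.map (fun z t => entanglementMap f f' (z t)) = μ := by
  have hfc : Continuous f := hf.1.continuous
  have hvc : Continuous (entanglementMap f f') :=
    (contDiff_entanglementMap hf hf'.1 hr.le).continuous
  have hFc : Continuous fun (z : Fin T → Vec n) t => f (z t) := by fun_prop
  have hVc : Continuous fun (z : Fin T → Vec n) t => entanglementMap f f' (z t) := by fun_prop
  have hemb : MeasurableEmbedding fun (z : Fin T → Vec n) t => f (z t) :=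
    hFc.measurableEmbedding fun z z' h => funext fun t => hf.injective (congrFun h t)
  have hcomp : (fun (z : Fin T → Vec n) t => f' (z t)) =
      (fun (z : Fin T → Vec n) t => f (z t)) ∘ fun z t => entanglementMap f f' (z t) := by
    funext z t
    exact (apply_entanglementMap hr.le _).symm
  rw [hcomp, ← Measure.map_map hFc.measurable hVc.measurable] at h
  rw [← hemb.comap_map μ, h, hemb.comap_map]

section

variable {dz dx da T : ℕ}

/-! ## Densities of a model -/

theorem contDiff_of_statMap {s : Fin dz → ℝ → ℝ} (hs : ContDiff ℝ 1 (statMap s)) (i : Fin dz) :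
    ContDiff ℝ 1 (s i) := by
  have h : s i = fun x => statMap s (fun _ => x) i := rfl
  rw [h]
  exact (contDiff_pi.1 hs i).comp (contDiff_pi.2 fun _ => contDiff_id)

/-- The exponential factor never vanishes, so the positivity set of `h i` is the set where a
mechanism is nonzero. Full support makes it only dense, which is why later identities are proved
there and extended by continuity. -/
theorem ExponentialFamily.dense_baseMeasure_pos {A : Set (Vec da)} {s h : Fin dz → ℝ → ℝ}
    {lam : NaturalParam dz da T} {θ : LatentModel dz dx da T} (hExp : ExponentialFamily A s h lam θ)
    (hIndep : CondIndependentLatents A θ) {t : Fin T} (zs : LatentPast dz t) {as : AuxPast da t}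
    (has : ∀ τ, as τ ∈ A) (i : Fin dz) : Dense {x | 0 < h i x} := by
  obtain ⟨ψ, hψ⟩ := hExp
  obtain ⟨-, hnn, -, hsupp⟩ := hIndep t i zs as has
  have hnn' : ∀ x, 0 ≤ h i x := fun x =>
    nonneg_of_mul_nonneg_left ((hψ t i x zs as has).symm ▸ hnn x) (Real.exp_pos _)
  have hset : {x | 0 < h i x} = Function.support fun x => θ.mech t i x zs as := by
    ext x
    simp only [Set.mem_ofPred_eq, Function.mem_support, hψ t i x zs as has, ne_eq, mul_eq_zero,
      Real.exp_ne_zero, or_false]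
    exact ⟨fun h => h.ne', fun h => lt_of_le_of_ne (hnn' x) (Ne.symm h)⟩
  rw [hset, dense_iff_closure_eq]
  exact hsupp

theorem dense_forall_pos {h : Fin dz → ℝ → ℝ} (hd : ∀ i, Dense {x | 0 < h i x}) :
    Dense {z : Vec dz | ∀ i, 0 < h i (z i)} := by
  convert dense_pi Set.univ fun i _ => hd i using 1
  ext z
  simp

theorem dense_forall_forall_pos {h : Fin dz → ℝ → ℝ} (hd : ∀ i, Dense {x | 0 < h i x}) :
    Dense {w : Fin T → Vec dz | ∀ t i, 0 < h i (w t i)} := by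
  convert dense_pi Set.univ fun (_ : Fin T) _ => dense_forall_pos hd using 1
  ext w
  simp

theorem ExponentialFamily.transition_pos {A : Set (Vec da)} {s h : Fin dz → ℝ → ℝ}
    {lam : NaturalParam dz da T} {θ : LatentModel dz dx da T} (hExp : ExponentialFamily A s h lam θ)
    {t : Fin T} {z : Vec dz} (hz : ∀ i, 0 < h i (z i)) (zs : LatentPast dz t) {as : AuxPast da t}
    (has : ∀ τ, as τ ∈ A) : 0 < θ.transition t z zs as := by
  obtain ⟨ψ, hψ⟩ := hExp
  refine Finset.prod_pos fun i _ => ?_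
  rw [hψ t i _ zs as has]
  exact mul_pos (hz i) (Real.exp_pos _)

theorem CondIndependentLatents.transition_nonneg {A : Set (Vec da)} {θ : LatentModel dz dx da T}
    (hIndep : CondIndependentLatents A θ) (t : Fin T) (z : Vec dz) (zs : LatentPast dz t)
    {as : AuxPast da t} (has : ∀ τ, as τ ∈ A) : 0 ≤ θ.transition t z zs as :=
  Finset.prod_nonneg fun i _ => (hIndep t i zs as has).2.1 _

theorem CondIndependentLatents.lintegral_transition {A : Set (Vec da)}
    {θ : LatentModel dz dx da T} (hIndep : CondIndependentLatents A θ) (t : Fin T)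
    (zs : LatentPast dz t) {as : AuxPast da t} (has : ∀ τ, as τ ∈ A) :
    ∫⁻ z, ENNReal.ofReal (θ.transition t z zs as) = 1 := by
  have h := lintegral_prod_causal (volume : Measure ℝ)
    (fun i (z : Fin dz → ℝ) => ENNReal.ofReal (θ.mech t i (z i) zs as))
    (fun i => ((hIndep t i zs as has).1.comp (measurable_pi_apply i)).ennreal_ofReal)
    (fun i z z' hz => by rw [hz i le_rfl])
    (fun i z => by simpa using (hIndep t i zs as has).2.2.1)
  rw [← h]
  refine lintegral_congr fun z => ?_
  exact ENNReal.ofReal_prod_of_nonneg fun i _ => (hIndep t i zs as has).2.1 _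

theorem SmoothTransitions.continuous_transition {A : Set (Vec da)} {θ : LatentModel dz dx da T}
    (hSmooth : SmoothTransitions A θ) (t : Fin T) {as : AuxPast da t} (has : ∀ τ, as τ ∈ A) :
    Continuous fun q : Vec dz × LatentPast dz t => θ.transition t q.1 q.2 as := by
  refine continuous_finsetProd _ fun i _ => ?_
  have h : Continuous fun q : Vec dz × LatentPast dz t => (q.1 i, q.2) := by fun_prop
  exact (hSmooth t i as has).continuous.comp h

theorem continuous_latentPast (t : Fin T) :
    Continuous fun z : Fin T → Vec dz => latentPast z t :=
  continuous_pi fun _ => continuous_apply _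

/-- The factor of the trajectory density at time `t`, as a function of the whole trajectory. -/
noncomputable def LatentModel.factor (θ : LatentModel dz dx da T) (a : Fin T → Vec da) (t : Fin T)
    (z : Fin T → Vec dz) : ℝ :=
  θ.transition t (z t) (latentPast z t) (auxPast a t)

theorem SmoothTransitions.continuous_factor {A : Set (Vec da)} {θ : LatentModel dz dx da T}
    (hSmooth : SmoothTransitions A θ) {a : Fin T → Vec da} (ha : ∀ t, a t ∈ A) (t : Fin T) :
    Continuous (θ.factor a t) :=
  (hSmooth.continuous_transition t fun _ => ha _).comp
    ((continuous_apply t).prodMk (continuous_latentPast t))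

theorem CondIndependentLatents.factor_nonneg {A : Set (Vec da)} {θ : LatentModel dz dx da T}
    (hIndep : CondIndependentLatents A θ) {a : Fin T → Vec da} (ha : ∀ t, a t ∈ A) (t : Fin T)
    (z : Fin T → Vec dz) : 0 ≤ θ.factor a t z :=
  hIndep.transition_nonneg _ _ _ fun _ => ha _

theorem latentPast_congr {z z' : Fin T → Vec dz} {t : Fin T} (h : ∀ s < t, z s = z' s) :
    latentPast z t = latentPast z' t :=
  funext fun τ => h _ τ.isLt

theorem LatentModel.factor_congr (θ : LatentModel dz dx da T) (a : Fin T → Vec da) (t : Fin T)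
    {z z' : Fin T → Vec dz} (h : ∀ s ≤ t, z s = z' s) : θ.factor a t z = θ.factor a t z' := by
  unfold LatentModel.factor
  rw [h t le_rfl, latentPast_congr fun s hs => h s hs.le]

theorem factor_update (θ : LatentModel dz dx da T) (a : Fin T → Vec da) (t : Fin T)
    (z : Fin T → Vec dz) (w : Vec dz) :
    θ.factor a t (Function.update z t w) = θ.transition t w (latentPast z t) (auxPast a t) := by
  unfold LatentModel.factor
  rw [Function.update_self, latentPast_congr fun s hs => Function.update_of_ne hs.ne _ _]

theorem isProbabilityMeasure_latentLaw {A : Set (Vec da)} {θ : LatentModel dz dx da T}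
    (hIndep : CondIndependentLatents A θ) (hSmooth : SmoothTransitions A θ) {a : Fin T → Vec da}
    (ha : ∀ t, a t ∈ A) : IsProbabilityMeasure (θ.latentLaw a) := by
  have h := lintegral_prod_causal (volume : Measure (Vec dz))
    (fun t z => ENNReal.ofReal (θ.factor a t z))
    (fun t => (hSmooth.continuous_factor ha t).measurable.ennreal_ofReal)
    (fun t z z' hz => by simp only [θ.factor_congr a t hz])
    (fun t z => by
      simp only [factor_update]
      exact hIndep.lintegral_transition t _ fun _ => ha _)
  constructor
  unfold LatentModel.latentLaw
  rw [withDensity_apply _ MeasurableSet.univ, Measure.restrict_univ, ← h]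
  refine lintegral_congr fun z => ?_
  exact ENNReal.ofReal_prod_of_nonneg fun t _ => hIndep.factor_nonneg ha t z

theorem map_latentLaw_eq {A : Set (Vec da)} {σsq : ℝ≥0} {θ θ' : LatentModel dz dx da T}
    (hIndep : CondIndependentLatents A θ) (hIndep' : CondIndependentLatents A θ')
    (hSmooth : SmoothTransitions A θ) (hSmooth' : SmoothTransitions A θ')
    (hf : Continuous θ.f) (hf' : Continuous θ'.f)
    (hObs : ObsEquiv A σsq θ θ') {a : Fin T → Vec da} (ha : ∀ t, a t ∈ A) :
    (θ.latentLaw a).map (fun z t => θ.f (z t)) = (θ'.latentLaw a).map (fun z t => θ'.f (z t)) := by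
  have := isProbabilityMeasure_latentLaw hIndep hSmooth ha
  have := isProbabilityMeasure_latentLaw hIndep' hSmooth' ha
  have h := hObs a ha
  rw [θ.obsLaw_eq_conv σsq a hf.measurable, θ'.obsLaw_eq_conv σsq a hf'.measurable] at h
  exact conv_right_cancel (charFunDual_noiseLaw_ne_zero dx T σsq) h

theorem continuous_trajectory {A : Set (Vec da)} {θ : LatentModel dz dx da T}
    (hSmooth : SmoothTransitions A θ) {a : Fin T → Vec da} (ha : ∀ t, a t ∈ A) :
    Continuous fun z => ∏ t, θ.factor a t z :=
  continuous_finsetProd _ fun t _ => hSmooth.continuous_factor ha t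

theorem range_subset_of_obsEquiv {A : Set (Vec da)} {σsq : ℝ≥0} {θ θ' : LatentModel dz dx da T}
    {s h : Fin dz → ℝ → ℝ} {lam' : NaturalParam dz da T}
    (hObsModel : ObservationModel θ) (hObsModel' : ObservationModel θ')
    (hIndep : CondIndependentLatents A θ) (hIndep' : CondIndependentLatents A θ')
    (hSmooth : SmoothTransitions A θ) (hSmooth' : SmoothTransitions A θ')
    (hExp' : ExponentialFamily A s h lam' θ') (hd : ∀ i, Dense {x | 0 < h i x})
    (hObs : ObsEquiv A σsq θ θ') (hT : 0 < T) {a : Fin T → Vec da} (ha : ∀ t, a t ∈ A) :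
    Set.range θ'.f ⊆ Set.range θ.f := by
  have hf := hObsModel.2.1.1.continuous
  have hf' := hObsModel'.2.1.1.continuous
  refine range_subset_of_map_eq hf hf' hObsModel.2.2 hT (continuous_trajectory hSmooth' ha) ?_
    (map_latentLaw_eq hIndep hIndep' hSmooth hSmooth' hf hf' hObs ha)
  refine (dense_forall_forall_pos hd).mono fun w hw => ?_
  exact Finset.prod_pos fun t _ => hExp'.transition_pos (hw t) _ fun _ => ha _

/-- Lets identities between functions of full trajectories be read as identities at an arbitrary
time and history. -/
theorem exists_trajectory {t : Fin T} (z : Vec dz) (zs : LatentPast dz t) :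
    ∃ w : Fin T → Vec dz, w t = z ∧ latentPast w t = zs := by
  refine ⟨fun s => if h : (s : ℕ) < t then zs ⟨s, h⟩ else z, by simp, ?_⟩
  funext τ
  simp [latentPast]

theorem exists_auxPast_eq {A : Set (Vec da)} {t : Fin T} {as : AuxPast da t}
    (has : ∀ τ, as τ ∈ A) : ∃ a : Fin T → Vec da, (∀ s, a s ∈ A) ∧ auxPast a t = as := by
  refine ⟨fun s => if h : (s : ℕ) < (t : ℕ) + 1 then as ⟨s, h⟩ else as 0, fun s => ?_, ?_⟩
  · dsimp only
    split_ifs <;> exact has _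
  · funext τ
    exact dif_pos τ.isLt

/-- Observationally equivalent models in a common exponential family are equivalent up to
diffeomorphism. -/
theorem diffEquiv_of_obsEquiv {A : Set (Vec da)} {σsq : ℝ≥0} {θ θ' : LatentModel dz dx da T}
    {s h : Fin dz → ℝ → ℝ} {lam lam' : NaturalParam dz da T}
    (hObsModel : ObservationModel θ) (hObsModel' : ObservationModel θ')
    (hIndep : CondIndependentLatents A θ) (hIndep' : CondIndependentLatents A θ')
    (hSmooth : SmoothTransitions A θ) (hSmooth' : SmoothTransitions A θ')
    (hExp : ExponentialFamily A s h lam θ) (hExp' : ExponentialFamily A s h lam' θ')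
    (hd : ∀ i, Dense {x | 0 < h i x}) (hObs : ObsEquiv A σsq θ θ') (hT : 0 < T)
    (hA : A.Nonempty) : DiffEquiv A θ θ' := by
  obtain ⟨a₀, ha₀⟩ := hA
  have hr : Set.range θ'.f = Set.range θ.f := by
    refine Set.Subset.antisymm ?_ ?_
    · exact range_subset_of_obsEquiv hObsModel hObsModel' hIndep hIndep' hSmooth hSmooth' hExp' hd
        hObs hT (a := fun _ => a₀) fun _ => ha₀
    · exact range_subset_of_obsEquiv hObsModel' hObsModel hIndep' hIndep hSmooth' hSmooth hExp hd
        (fun a ha => (hObs a ha).symm) hT (a := fun _ => a₀) fun _ => ha₀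
  have hv : IsDiffeo (entanglementMap θ.f θ'.f) :=
    isDiffeo_entanglementMap hObsModel.2.1 hObsModel'.2.1 hr
  refine ⟨hr.symm, hv, fun t z zs as has => ?_⟩
  set v := entanglementMap θ.f θ'.f with hvdef
  have hvc : Continuous v := hv.1.1.continuous
  have hVc : Continuous fun (z : Fin T → Vec dz) t => v (z t) := by fun_prop
  obtain ⟨a, ha, rfl⟩ := exists_auxPast_eq has
  obtain ⟨w, rfl, rfl⟩ := exists_trajectory z zs
  have hmap : (θ'.latentLaw a).map (fun z t => v (z t)) = θ.latentLaw a :=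
    map_entanglementMap hObsModel.2.1 hObsModel'.2.1 hr
      (map_latentLaw_eq hIndep hIndep' hSmooth hSmooth' hObsModel.2.1.1.continuous
        hObsModel'.2.1.1.continuous hObs ha)
  have hprod := hv.density_eq (continuous_trajectory hSmooth ha) (continuous_trajectory hSmooth' ha)
    (fun z => Finset.prod_nonneg fun t _ => hIndep.factor_nonneg ha t z)
    (fun z => Finset.prod_nonneg fun t _ => hIndep'.factor_nonneg ha t z) hmap
  -- The factors of the pulled-back density of `θ`. They are causal because `v` acts time by time,
  -- and normalized by the change of variables `y ↦ v y` in the last coordinate.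
  set q : Fin T → (Fin T → Vec dz) → ℝ := fun t z =>
    θ.factor a t (fun t => v (z t)) * |(jacobian v (z t)).det| with hq
  have hqc : ∀ t, Continuous (q t) := fun t =>
    ((hSmooth.continuous_factor ha t).comp hVc).mul
      (hv.continuous_det_jacobian.comp (continuous_apply t)).abs
  have hq0 : ∀ t z, 0 ≤ q t z := fun t z =>
    mul_nonneg (hIndep.factor_nonneg ha t _) (abs_nonneg _)
  have hcausal := causal_factors_mul_eq (volume : Measure (Vec dz))
    (fun t z => ENNReal.ofReal (θ'.factor a t z)) (fun t z => ENNReal.ofReal (q t z))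
    (fun t => (hSmooth'.continuous_factor ha t).measurable.ennreal_ofReal)
    (fun t => (hqc t).measurable.ennreal_ofReal)
    (fun t z z' hz => by simp only [θ'.factor_congr a t hz])
    (fun t z z' hz => by
      simp only [hq, hz t le_rfl,
        θ.factor_congr a t (z := fun t => v (z t)) fun s hs => congrArg v (hz s hs)])
    (fun t z => by
      simp only [factor_update]
      exact hIndep'.lintegral_transition t _ fun _ => ha _)
    (fun t z => by
      rw [← hIndep.lintegral_transition t (latentPast (fun s => v (z s)) t)
        (as := auxPast a t) fun _ => ha _, ← hv.lintegral_comp fun y =>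
          ENNReal.ofReal (θ.transition t y (latentPast (fun s => v (z s)) t) (auxPast a t))]
      refine lintegral_congr fun y => ?_
      rw [← ENNReal.ofReal_mul (hIndep.transition_nonneg t _ _ (as := auxPast a t) fun _ => ha _)]
      simp only [hq, LatentModel.factor, Function.update_self]
      rw [latentPast_congr (z := fun s => v (Function.update z t y s)) (z' := fun s => v (z s))
        fun s hs => by rw [Function.update_of_ne hs.ne]])
    (fun z => by
      rw [← ENNReal.ofReal_prod_of_nonneg fun t _ => hIndep'.factor_nonneg ha t z,
        ← ENNReal.ofReal_prod_of_nonneg fun t _ => hq0 t z, hprod z, ← Finset.prod_mul_distrib]) t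
  have hfactor : θ'.factor a t = q t := by
    -- Where all base measures are positive the prefix product is nonzero and finite, hence cancels.
    refine Continuous.ext_on (dense_forall_forall_pos hd) (hSmooth'.continuous_factor ha t) (hqc t)
      fun w hw => ?_
    have hpos : ∏ s with s < t, ENNReal.ofReal (θ'.factor a s w) ≠ 0 := by
      refine Finset.prod_ne_zero_iff.2 fun s _ => ?_
      have := hExp'.transition_pos (hw s) (latentPast w s) (as := auxPast a s) fun _ => ha _
      exact (ENNReal.ofReal_pos.2 this).ne'
    have htop : ∏ s with s < t, ENNReal.ofReal (θ'.factor a s w) ≠ ⊤ :=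
      ENNReal.prod_ne_top fun s _ => ENNReal.ofReal_ne_top
    have := (ENNReal.mul_right_inj hpos htop).1 (hcausal w)
    exact (ENNReal.ofReal_eq_ofReal_iff (hIndep'.factor_nonneg ha t w) (hq0 t w)).1 this
  exact congrFun hfactor w

/-! ## Exponential families -/

theorem continuous_dotProduct_statMap {X : Type*} [TopologicalSpace X] {s : Fin dz → ℝ → ℝ}
    (hs : ∀ i, Continuous (s i)) {u : X → Vec dz} (hu : Continuous u) (d : Vec dz) :
    Continuous fun x => statMap s (u x) ⬝ᵥ d := by
  refine continuous_finsetSum _ fun i _ => ?_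
  exact ((hs i).comp ((continuous_apply i).comp hu)).mul continuous_const

theorem transition_eq_of_expFamily {A : Set (Vec da)} {s h : Fin dz → ℝ → ℝ}
    {lam ψ : NaturalParam dz da T} {θ : LatentModel dz dx da T}
    (hψ : ∀ (t : Fin T) (i : Fin dz) (x : ℝ) (zs : LatentPast dz t) (as : AuxPast da t),
      (∀ τ, as τ ∈ A) →
      θ.mech t i x zs as = h i x * Real.exp (s i x * lam t zs as i - ψ t zs as i))
    {t : Fin T} (z : Vec dz) (zs : LatentPast dz t) {as : AuxPast da t} (has : ∀ τ, as τ ∈ A) :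
    θ.transition t z zs as =
      (∏ i, h i (z i)) * Real.exp (statMap s z ⬝ᵥ lam t zs as - ∑ i, ψ t zs as i) := by
  unfold LatentModel.transition
  simp_rw [hψ t _ _ zs as has]
  rw [Finset.prod_mul_distrib, ← Real.exp_sum, Finset.sum_sub_distrib]
  rfl

/-- In equivalent models of a common exponential family, differences of natural parameters pair
with the sufficient statistics in the same way, up to a constant. -/
theorem exists_dotProduct_eq {A : Set (Vec da)} {s h : Fin dz → ℝ → ℝ}
    {lam lam' : NaturalParam dz da T} {θ θ' : LatentModel dz dx da T}
    (hExp : ExponentialFamily A s h lam θ) (hExp' : ExponentialFamily A s h lam' θ')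
    (hd : ∀ i, Dense {x | 0 < h i x}) (hs : ∀ i, Continuous (s i)) {v : Vec dz → Vec dz}
    (hv : Continuous v) {J : Vec dz → ℝ}
    (heq : ∀ (t : Fin T) (z : Vec dz) (zs : LatentPast dz t) (as : AuxPast da t),
      (∀ τ, as τ ∈ A) →
      θ'.transition t z zs as = θ.transition t (v z) (fun τ => v (zs τ)) as * J z)
    {t t₀ : Fin T} (zs : LatentPast dz t) (zs₀ : LatentPast dz t₀) {as : AuxPast da t}
    {as₀ : AuxPast da t₀} (has : ∀ τ, as τ ∈ A) (has₀ : ∀ τ, as₀ τ ∈ A) :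
    ∃ c : ℝ, ∀ z,
      statMap s (v z) ⬝ᵥ (lam t (fun τ => v (zs τ)) as - lam t₀ (fun τ => v (zs₀ τ)) as₀) =
        statMap s z ⬝ᵥ (lam' t zs as - lam' t₀ zs₀ as₀) + c := by
  have hpos := fun (z : Vec dz) (hz : ∀ i, 0 < h i (z i)) => hExp'.transition_pos hz zs has
  obtain ⟨ψ, hψ⟩ := hExp
  obtain ⟨ψ', hψ'⟩ := hExp'
  refine ⟨(∑ i, ψ t (fun τ => v (zs τ)) as i - ∑ i, ψ t₀ (fun τ => v (zs₀ τ)) as₀ i) -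
    (∑ i, ψ' t zs as i - ∑ i, ψ' t₀ zs₀ as₀ i), fun z => ?_⟩
  refine congrFun (Continuous.ext_on (dense_forall_pos hd) (continuous_dotProduct_statMap hs hv _)
    ((continuous_dotProduct_statMap hs continuous_id _).add continuous_const) fun z hz => ?_) z
  have h1 := heq t z zs as has
  have h2 := heq t₀ z zs₀ as₀ has₀
  have h3 := (hpos z hz).ne'
  rw [transition_eq_of_expFamily hψ _ _ has, transition_eq_of_expFamily hψ' _ _ has] at h1
  rw [transition_eq_of_expFamily hψ _ _ has₀, transition_eq_of_expFamily hψ' _ _ has₀] at h2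
  rw [transition_eq_of_expFamily hψ' _ _ has, h1] at h3
  -- Positivity of the `θ'` density at `z` forces both `J z` and the base measure at `v z` to be
  -- nonzero, though neither is assumed so.
  have hJ := right_ne_zero_of_mul h3
  have hH := left_ne_zero_of_mul (left_ne_zero_of_mul h3)
  have hH' : ∏ i, h i (z i) ≠ 0 := (Finset.prod_pos fun i _ => hz i).ne'
  set E₁ := statMap s z ⬝ᵥ lam' t zs as - ∑ i, ψ' t zs as i with hE₁
  set E₂ := statMap s z ⬝ᵥ lam' t₀ zs₀ as₀ - ∑ i, ψ' t₀ zs₀ as₀ i with hE₂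
  set E₃ := statMap s (v z) ⬝ᵥ lam t (fun τ => v (zs τ)) as -
    ∑ i, ψ t (fun τ => v (zs τ)) as i with hE₃
  set E₄ := statMap s (v z) ⬝ᵥ lam t₀ (fun τ => v (zs₀ τ)) as₀ -
    ∑ i, ψ t₀ (fun τ => v (zs₀ τ)) as₀ i with hE₄
  -- Cross-multiplying the density identities at the two histories cancels the base measures and `J
  -- z`.
  have hexp : Real.exp (E₁ + E₄) = Real.exp (E₂ + E₃) := by
    rw [Real.exp_add, Real.exp_add]
    refine mul_left_cancel₀ (mul_ne_zero (mul_ne_zero hH' hH) hJ) ?_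
    linear_combination (∏ i, h i (v z i)) * J z * Real.exp E₄ * h1 -
      (∏ i, h i (v z i)) * J z * Real.exp E₃ * h2
  have hE := Real.exp_injective hexp
  simp only [id, dotProduct_sub, Pi.add_apply]
  linear_combination -hE - hE₁ + hE₂ + hE₃ - hE₄

/-- Moving only the `i`-th coordinate makes `d i * s i` constant, which minimality forbids unless `d
i = 0`. -/
theorem eq_zero_of_dotProduct_statMap {s : Fin dz → ℝ → ℝ} (hMin : ∀ i, MinimalStatistic (s i))
    {d : Vec dz} {c : ℝ} (h : ∀ z, statMap s z ⬝ᵥ d = c) : d = 0 := by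
  funext i
  by_contra hne
  refine hMin i ⟨d i, hne, c - ∑ j ∈ Finset.univ.erase i, s j 0 * d j, fun x => ?_⟩
  have hx := h (Function.update 0 i x)
  unfold dotProduct at hx
  rw [← Finset.add_sum_erase _ _ (Finset.mem_univ i)] at hx
  rw [← hx, Finset.sum_congr rfl (g := fun j => s j 0 * d j) fun j hj => by
    simp [statMap, Function.update_of_ne (Finset.ne_of_mem_erase hj)]]
  simp [statMap, mul_comm]

/-- The natural parameters are determined by the values of the mechanism at two points. -/
theorem ExponentialFamily.exists_naturalParam_eq {A : Set (Vec da)} {s h : Fin dz → ℝ → ℝ}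
    {lam : NaturalParam dz da T} {θ : LatentModel dz dx da T}
    (hExp : ExponentialFamily A s h lam θ) {i : Fin dz} (hd : Dense {x | 0 < h i x})
    (hs : Continuous (s i)) (hMin : MinimalStatistic (s i)) :
    ∃ x y k c : ℝ, ∀ (t : Fin T) (zs : LatentPast dz t) (as : AuxPast da t), (∀ τ, as τ ∈ A) →
      θ.mech t i x zs as ≠ 0 ∧ θ.mech t i y zs as ≠ 0 ∧
      lam t zs as i =
        (Real.log (θ.mech t i x zs as) - Real.log (θ.mech t i y zs as) - c) * k := by
  obtain ⟨ψ, hψ⟩ := hExp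
  obtain ⟨y, hy⟩ := hd.nonempty
  -- Otherwise `s i` would be constant on a dense set, hence everywhere. Two such points let the
  -- log-ratio eliminate `ψ`.
  obtain ⟨x, hx, hxy⟩ : ∃ x, 0 < h i x ∧ s i x ≠ s i y := by
    by_contra! hcon
    refine hMin ⟨1, one_ne_zero, s i y, fun x => ?_⟩
    rw [one_mul]
    exact congrFun (Continuous.ext_on hd hs continuous_const fun x hx => hcon x hx) x
  have hy : 0 < h i y := hy
  refine ⟨x, y, (s i x - s i y)⁻¹, Real.log (h i x) - Real.log (h i y), fun t zs as has => ?_⟩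
  rw [hψ t i x zs as has, hψ t i y zs as has]
  refine ⟨mul_ne_zero hx.ne' (Real.exp_ne_zero _), mul_ne_zero hy.ne' (Real.exp_ne_zero _), ?_⟩
  rw [Real.log_mul hx.ne' (Real.exp_ne_zero _), Real.log_mul hy.ne' (Real.exp_ne_zero _),
    Real.log_exp, Real.log_exp, eq_mul_inv_iff_mul_eq₀ (sub_ne_zero.2 hxy)]
  ring

/-- The log-ratio formula for `lam` transfers smoothness of the mechanisms; the Markov property
passes to `lam` in the same way. -/
theorem differentiable_naturalParam {A : Set (Vec da)} {s h : Fin dz → ℝ → ℝ}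
    {lam : NaturalParam dz da T} {θ : LatentModel dz dx da T}
    (hExp : ExponentialFamily A s h lam θ) (hSmooth : SmoothTransitions A θ)
    (hd : ∀ i, Dense {x | 0 < h i x}) (hs : ∀ i, Continuous (s i))
    (hMin : ∀ i, MinimalStatistic (s i)) (t : Fin T) {as : AuxPast da t} (has : ∀ τ, as τ ∈ A) :
    Differentiable ℝ fun zs : LatentPast dz t => lam t zs as := by
  refine differentiable_pi.2 fun i => ?_
  obtain ⟨x, y, k, c, hxy⟩ := hExp.exists_naturalParam_eq (hd i) (hs i) (hMin i)
  have hmech : ∀ x, Differentiable ℝ fun zs : LatentPast dz t => θ.mech t i x zs as := fun x =>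
    ((hSmooth t i as has).comp (contDiff_prodMk_right x)).differentiable two_ne_zero
  simp_rw [(hxy t _ as has).2.2]
  exact ((((hmech x).log fun zs => (hxy t zs as has).1).sub
    ((hmech y).log fun zs => (hxy t zs as has).2.1)).sub_const c).mul_const k

theorem MarkovWrtGraph.naturalParam_congr {A : Set (Vec da)} {s h : Fin dz → ℝ → ℝ}
    {lam : NaturalParam dz da T} {θ : LatentModel dz dx da T} (hMarkov : MarkovWrtGraph A θ)
    (hExp : ExponentialFamily A s h lam θ) {i : Fin dz} (hd : Dense {x | 0 < h i x})
    (hs : Continuous (s i)) (hMin : MinimalStatistic (s i)) {t : Fin T} {zs zs' : LatentPast dz t}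
    {as : AuxPast da t} (has : ∀ τ, as τ ∈ A)
    (hzs : ∀ τ j, θ.Gz i j = 1 → zs τ j = zs' τ j) : lam t zs as i = lam t zs' as i := by
  obtain ⟨x, y, k, c, hxy⟩ := hExp.exists_naturalParam_eq hd hs hMin
  have hmech := hMarkov t i zs zs' as as has has hzs fun _ _ _ => rfl
  rw [(hxy t zs as has).2.2, (hxy t zs' as has).2.2, hmech x, hmech y]

/-! ## Jacobians -/

theorem differentiable_naturalParam_update {t : Fin T} {lam : NaturalParam dz da T}
    {as : AuxPast da t} (hlam : Differentiable ℝ fun zs : LatentPast dz t => lam t zs as) (τ : Fin (t : ℕ))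
    (zs : LatentPast dz t) :
    Differentiable ℝ fun w => lam t (Function.update zs τ w) as :=
  hlam.comp fun w => (hasFDerivAt_update zs w).differentiableAt

theorem jacobian_apply_eq_zero {m n : ℕ} {F : Vec n → Vec m} {x : Vec n}
    (hF : DifferentiableAt ℝ F x) {i : Fin m} {j : Fin n}
    (h : ∀ y, (∀ k ≠ j, y k = x k) → F y i = F x i) : jacobian F x i j = 0 := by
  have hline := hasDerivAt_pi.1 (hF.hasFDerivAt.hasLineDerivAt (Pi.single j 1)) i
  have hconst : (fun r : ℝ => F (x + r • Pi.single j 1) i) = fun _ => F x i := by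
    funext r
    refine h _ fun k hk => ?_
    simp [Pi.single_eq_of_ne hk]
  rw [hconst] at hline
  have h0 := hline.unique (hasDerivAt_const _ _)
  unfold jacobian
  rw [LinearMap.toMatrix'_apply]
  exact h0

theorem jacobianAt_mem_alignedSubspace {A : Set (Vec da)} {s h : Fin dz → ℝ → ℝ}
    {lam : NaturalParam dz da T} {θ : LatentModel dz dx da T} (hMarkov : MarkovWrtGraph A θ)
    (hExp : ExponentialFamily A s h lam θ) (hSmooth : SmoothTransitions A θ)
    (hd : ∀ i, Dense {x | 0 < h i x}) (hs : ∀ i, Continuous (s i))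
    (hMin : ∀ i, MinimalStatistic (s i)) (t : Fin T) (τ : Fin (t : ℕ)) (zs : LatentPast dz t)
    {as : AuxPast da t} (has : ∀ τ, as τ ∈ A) :
    jacobianAt lam t τ zs as ∈ alignedSubspace θ.Gz := by
  intro i j hij
  refine jacobian_apply_eq_zero (differentiable_naturalParam_update
    (differentiable_naturalParam hExp hSmooth hd hs hMin t has) τ zs _) fun y hy => ?_
  refine hMarkov.naturalParam_congr hExp (hd i) (hs i) (hMin i) has fun ρ k hk => ?_
  by_cases hρ : ρ = τ
  · subst hρ
    simp only [Function.update_self]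
    exact hy k fun hkj => by simp [hkj, hij] at hk
  · simp only [Function.update_of_ne hρ]

theorem jacobian_statMap {s : Fin dz → ℝ → ℝ} (hs : ContDiff ℝ 1 (statMap s)) (z : Vec dz) :
    jacobian (statMap s) z = Matrix.diagonal fun i => jacobian (statMap s) z i i := by
  ext i j
  rw [Matrix.diagonal_apply]
  split_ifs with hij
  · rw [hij]
  · exact jacobian_apply_eq_zero (hs.differentiable one_ne_zero z) fun y hy =>
      congrArg (s i) (hy i hij)

theorem mul_inv_jacobian_statMap_mem {s : Fin dz → ℝ → ℝ} (hs : ContDiff ℝ 1 (statMap s))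
    (z : Vec dz) {G M : Matrix (Fin dz) (Fin dz) ℝ} (hM : M ∈ alignedSubspace G) :
    M * (jacobian (statMap s) z)⁻¹ ∈ alignedSubspace G := by
  intro i j hij
  rw [jacobian_statMap hs z, Matrix.inv_diagonal, Matrix.mul_diagonal, hM i j hij, zero_mul]

theorem fun_update_comp {t : Fin T} (v : Vec dz → Vec dz) (zs : LatentPast dz t) (τ : Fin (t : ℕ))
    (w : Vec dz) :
    (fun ρ => v (Function.update zs τ w ρ)) = Function.update (fun ρ => v (zs ρ)) τ (v w) := by
  funext ρ
  by_cases hρ : ρ = τ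
  · subst hρ
    simp
  · simp [hρ]

/-! ## Quasi-linearity of the entanglement map -/

theorem dotProduct_mulVec_add {n : ℕ} (L : Matrix (Fin n) (Fin n) ℝ) (x b d : Vec n) :
    (L.mulVec x + b) ⬝ᵥ d = x ⬝ᵥ L.transpose.mulVec d + b ⬝ᵥ d := by
  rw [add_dotProduct, Matrix.mulVec_transpose, dotProduct_comm (L.mulVec x),
    Matrix.dotProduct_mulVec, dotProduct_comm x]

/-- Under sufficient variability, the sufficient statistics of equivalent models are related by an
affine map. -/
theorem exists_statMap_eq_mulVec_add {A : Set (Vec da)} {s : Fin dz → ℝ → ℝ}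
    {lam lam' : NaturalParam dz da T} {v w : Vec dz → Vec dz} (hvw : ∀ z, v (w z) = z)
    (hdot : ∀ (t t₀ : Fin T) (zs : LatentPast dz t) (zs₀ : LatentPast dz t₀) (as : AuxPast da t)
      (as₀ : AuxPast da t₀), (∀ τ, as τ ∈ A) → (∀ τ, as₀ τ ∈ A) → ∃ c : ℝ, ∀ z,
      statMap s (v z) ⬝ᵥ (lam t (fun τ => v (zs τ)) as - lam t₀ (fun τ => v (zs₀ τ)) as₀) =
        statMap s z ⬝ᵥ (lam' t zs as - lam' t₀ zs₀ as₀) + c)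
    (hVar : SufficientVariability A lam) :
    ∃ (L : Matrix (Fin dz) (Fin dz) ℝ) (b : Vec dz),
      ∀ z, statMap s (v z) = L.mulVec (statMap s z) + b := by
  obtain ⟨t, zs, as, has, hli⟩ := hVar
  -- Using the histories `w(z₍ᵣ₎)` makes `v` return the given ones, so the independent differences
  -- of `lam` appear as the rows of `W`.
  choose c hc using fun r : Fin dz =>
    hdot (t r.succ) (t 0) (fun τ => w (zs r.succ τ)) (fun τ => w (zs 0 τ)) _ _ (has r.succ) (has 0)
  simp only [hvw] at hc
  set W : Matrix (Fin dz) (Fin dz) ℝ :=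
    fun r => lam (t r.succ) (zs r.succ) (as r.succ) - lam (t 0) (zs 0) (as 0) with hW
  set W' : Matrix (Fin dz) (Fin dz) ℝ := fun r =>
    lam' (t r.succ) (fun τ => w (zs r.succ τ)) (as r.succ) -
      lam' (t 0) (fun τ => w (zs 0 τ)) (as 0) with hW'
  have hWu : IsUnit W := Matrix.linearIndependent_rows_iff_isUnit.1 hli
  have hdet := (Matrix.isUnit_iff_isUnit_det W).1 hWu
  refine ⟨W⁻¹ * W', W⁻¹.mulVec c, fun z => ?_⟩
  have hz : W.mulVec (statMap s (v z)) = W'.mulVec (statMap s z) + c := by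
    funext r
    rw [Pi.add_apply]
    unfold Matrix.mulVec
    rw [dotProduct_comm, dotProduct_comm (W' r)]
    exact hc r z
  rw [← Matrix.mulVec_mulVec, ← Matrix.mulVec_add, ← hz, Matrix.mulVec_mulVec,
    Matrix.nonsing_inv_mul _ hdet, Matrix.one_mulVec]

theorem jacobian_statMap_mul_jacobian {s : Fin dz → ℝ → ℝ} (hs : ContDiff ℝ 1 (statMap s))
    {v : Vec dz → Vec dz} (hv : ContDiff ℝ 1 v) {L : Matrix (Fin dz) (Fin dz) ℝ} {b : Vec dz}
    (hL : ∀ z, statMap s (v z) = L.mulVec (statMap s z) + b) (z : Vec dz) :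
    jacobian (statMap s) (v z) * jacobian v z = L * jacobian (statMap s) z := by
  have hsd := hs.differentiable one_ne_zero
  rw [← jacobian_comp (hsd _) (hv.differentiable one_ne_zero z), funext hL]
  have hLd : Differentiable ℝ fun y => L.mulVec y + b :=
    (LinearMap.toContinuousLinearMap (Matrix.toLin' L)).differentiable.add_const b
  rw [jacobian_comp (g := fun y => L.mulVec y + b) (hLd _) (hsd z), jacobian_mulVec_add]

/-- By the chain rule `Ds(v(0)) Dv(0) = L Ds(0)`, and the left side is invertible. -/
theorem isUnit_of_statMap_eq {s : Fin dz → ℝ → ℝ} (hs : ContDiff ℝ 1 (statMap s))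
    (hsu : ∀ z, IsUnit (jacobian (statMap s) z)) {v : Vec dz → Vec dz} (hv : IsDiffeo v)
    {L : Matrix (Fin dz) (Fin dz) ℝ} {b : Vec dz}
    (hL : ∀ z, statMap s (v z) = L.mulVec (statMap s z) + b) : IsUnit L := by
  have h := (hsu (v 0)).mul (hv.isUnit_jacobian 0)
  rw [jacobian_statMap_mul_jacobian hs hv.1.1 hL, Matrix.isUnit_iff_isUnit_det, Matrix.det_mul] at h
  exact (Matrix.isUnit_iff_isUnit_det L).2 (isUnit_of_mul_isUnit_left h)

/-- Differences of natural parameters are related by the transposed matrix. -/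
theorem naturalParam_sub_eq {A : Set (Vec da)} {s : Fin dz → ℝ → ℝ}
    {lam lam' : NaturalParam dz da T} {v : Vec dz → Vec dz} (hMin : ∀ i, MinimalStatistic (s i))
    {L : Matrix (Fin dz) (Fin dz) ℝ} {b : Vec dz}
    (hL : ∀ z, statMap s (v z) = L.mulVec (statMap s z) + b)
    (hdot : ∀ (t t₀ : Fin T) (zs : LatentPast dz t) (zs₀ : LatentPast dz t₀) (as : AuxPast da t)
      (as₀ : AuxPast da t₀), (∀ τ, as τ ∈ A) → (∀ τ, as₀ τ ∈ A) → ∃ c : ℝ, ∀ z,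
      statMap s (v z) ⬝ᵥ (lam t (fun τ => v (zs τ)) as - lam t₀ (fun τ => v (zs₀ τ)) as₀) =
        statMap s z ⬝ᵥ (lam' t zs as - lam' t₀ zs₀ as₀) + c)
    {t t₀ : Fin T} (zs : LatentPast dz t) (zs₀ : LatentPast dz t₀) {as : AuxPast da t}
    {as₀ : AuxPast da t₀} (has : ∀ τ, as τ ∈ A) (has₀ : ∀ τ, as₀ τ ∈ A) :
    lam' t zs as - lam' t₀ zs₀ as₀ =
      L.transpose.mulVec (lam t (fun τ => v (zs τ)) as - lam t₀ (fun τ => v (zs₀ τ)) as₀) := by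
  obtain ⟨c, hc⟩ := hdot t t₀ zs zs₀ as as₀ has has₀
  -- Inserting the affine relation leaves a vector whose pairing with `s(z)` does not depend on `z`;
  -- minimality kills it.
  refine (sub_eq_zero.1 (eq_zero_of_dotProduct_statMap hMin
    (c := c - b ⬝ᵥ (lam t (fun τ => v (zs τ)) as - lam t₀ (fun τ => v (zs₀ τ)) as₀))
    fun z => ?_)).symm
  have h := hc z
  rw [hL, dotProduct_mulVec_add] at h
  rw [dotProduct_sub]
  linear_combination h

/-- Differentiate `λ'(z) = Lᵀ λ(v(z)) + const` in `z^τ`, then substitute `Dv = Ds(v)⁻¹ L Ds`; the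
trailing `Ds` cancels and turns the relation into a conjugation by `L`. -/
theorem jacobianAt_mul_inv_eq {s : Fin dz → ℝ → ℝ}
    {lam lam' : NaturalParam dz da T} {v : Vec dz → Vec dz} (hv : ContDiff ℝ 1 v)
    (hs : ContDiff ℝ 1 (statMap s)) (hsu : ∀ z, IsUnit (jacobian (statMap s) z))
    {L : Matrix (Fin dz) (Fin dz) ℝ} {b : Vec dz}
    (hL : ∀ z, statMap s (v z) = L.mulVec (statMap s z) + b) {t : Fin T} {as : AuxPast da t}
    (hlam : Differentiable ℝ fun zs : LatentPast dz t => lam t zs as)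
    (hsub : ∀ zs zs₀ : LatentPast dz t, lam' t zs as - lam' t zs₀ as =
      L.transpose.mulVec (lam t (fun τ => v (zs τ)) as - lam t (fun τ => v (zs₀ τ)) as))
    (τ : Fin (t : ℕ)) (zs : LatentPast dz t) :
    jacobianAt lam' t τ zs as * (jacobian (statMap s) (zs τ))⁻¹ =
      L.transpose * (jacobianAt lam t τ (fun ρ => v (zs ρ)) as *
        (jacobian (statMap s) (v (zs τ)))⁻¹) * L := by
  have hfun : (fun w => lam' t (Function.update zs τ w) as) = fun w =>
      L.transpose.mulVec (lam t (Function.update (fun ρ => v (zs ρ)) τ (v w)) as) +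
        (lam' t zs as - L.transpose.mulVec (lam t (fun ρ => v (zs ρ)) as)) := by
    funext w
    rw [← fun_update_comp v zs τ w]
    have h := hsub (Function.update zs τ w) zs
    rw [Matrix.mulVec_sub] at h
    rw [sub_eq_iff_eq_add.1 h]
    abel
  have hd := differentiable_naturalParam_update hlam τ fun ρ => v (zs ρ)
  have hvd := hv.differentiable one_ne_zero (zs τ)
  have hLd : ∀ c : Vec dz, Differentiable ℝ fun y => L.transpose.mulVec y + c := fun c =>
    (LinearMap.toContinuousLinearMap (Matrix.toLin' L.transpose)).differentiable.add_const c
  have hjac : jacobianAt lam' t τ zs as =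
      L.transpose * (jacobianAt lam t τ (fun ρ => v (zs ρ)) as * jacobian v (zs τ)) := by
    unfold jacobianAt
    have hcomp : DifferentiableAt ℝ
        (fun w => lam t (Function.update (fun ρ => v (zs ρ)) τ (v w)) as) (zs τ) :=
      (hd _).comp (zs τ) hvd
    rw [hfun, jacobian_comp (g := fun y => L.transpose.mulVec y + _) (hLd _ _) hcomp,
      jacobian_mulVec_add,
      jacobian_comp (g := fun w => lam t (Function.update (fun ρ => v (zs ρ)) τ w) as) (hd _) hvd]
  have hdet := fun z => (Matrix.isUnit_iff_isUnit_det _).1 (hsu z)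
  have hJv : jacobian v (zs τ) =
      (jacobian (statMap s) (v (zs τ)))⁻¹ * (L * jacobian (statMap s) (zs τ)) := by
    rw [← jacobian_statMap_mul_jacobian hs hv hL, Matrix.nonsing_inv_mul_cancel_left _ _ (hdet _)]
  rw [hjac, hJv]
  simp only [Matrix.mul_assoc, Matrix.mul_nonsing_inv _ (hdet _), Matrix.mul_one]

theorem conj_mem_alignedSubspace_of_span {n : ℕ} {ι : Type*} {M : ι → Matrix (Fin n) (Fin n) ℝ}
    {G G' L : Matrix (Fin n) (Fin n) ℝ}
    (hspan : Submodule.span ℝ (Set.range M) = alignedSubspace G)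
    (h : ∀ r, L.transpose * M r * L ∈ alignedSubspace G') :
    ∀ N ∈ alignedSubspace G, L.transpose * N * L ∈ alignedSubspace G' := by
  have hle : Submodule.span ℝ (Set.range M) ≤ (alignedSubspace G').comap
      ((LinearMap.mulRight ℝ L).comp (LinearMap.mulLeft ℝ L.transpose)) := by
    rw [Submodule.span_le]
    rintro _ ⟨r, rfl⟩
    exact h r
  exact fun N hN => hle (hspan ▸ hN)

/-! ## Dependency graphs -/

theorem depGraph_eq_zero {n m : ℕ} {c : Vec n → Vec m} {i : Fin m} {j : Fin n}
    (h : ∀ a a', (∀ k ≠ j, a k = a' k) → c a i = c a' i) : depGraph c i j = 0 := by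
  unfold depGraph
  refine if_pos ⟨fun b => c (fun k => if hk : k ≠ j then b ⟨k, hk⟩ else 0) i, fun a => ?_⟩
  exact h _ _ fun k hk => by simp [hk]

theorem IsDiffeo.comp_permMatrix {n : ℕ} {v w : Vec n → Vec n} (hv : ContDiff ℝ 1 v)
    (hw : ContDiff ℝ 1 w) (hwv : ∀ z, w (v z) = z) (hvw : ∀ z, v (w z) = z)
    (σ : Equiv.Perm (Fin n)) : IsDiffeo fun z => v ((σ.permMatrix ℝ).mulVec z) := by
  have hlin : ∀ M : Matrix (Fin n) (Fin n) ℝ, ContDiff ℝ 1 fun z => M.mulVec z := fun M =>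
    (LinearMap.toContinuousLinearMap (Matrix.toLin' M)).contDiff
  refine isDiffeo_of_inverse (w := fun z => (σ.permMatrix ℝ).transpose.mulVec (w z))
    (hv.comp (hlin _)) ((hlin _).comp hw) (fun z => ?_) fun z => ?_
  · rw [hwv, Matrix.mulVec_mulVec, transpose_permMatrix_mul_self, Matrix.one_mulVec]
  · simp only [Matrix.mulVec_mulVec, permMatrix_mul_transpose_self, Matrix.one_mulVec, hvw]

/-- With `P` the matrix of `σ`, `sᵢ(vᵢ(P z)) = Σⱼ L i j * sⱼ(z_{σ j}) + bᵢ`, and the coefficient of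
the term involving `z_k` is `(L P) i k`. If it is zero, injectivity of `sᵢ` removes `z_k` from `vᵢ(P
z)`. -/
theorem mul_permMatrix_ne_zero_of_depGraph {s : Fin dz → ℝ → ℝ}
    (hinj : Function.Injective (statMap s)) {v : Vec dz → Vec dz}
    {L : Matrix (Fin dz) (Fin dz) ℝ} {b : Vec dz}
    (hL : ∀ z, statMap s (v z) = L.mulVec (statMap s z) + b) (σ : Equiv.Perm (Fin dz))
    (i k : Fin dz) (hne : depGraph (fun z => v ((σ.permMatrix ℝ).mulVec z)) i k ≠ 0) :
    (L * σ.permMatrix ℝ) i k ≠ 0 := by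
  intro h0
  refine hne (depGraph_eq_zero fun a a' haa' => ?_)
  have hsi : Function.Injective (s i) := by
    intro x y hxy
    have h : Function.update (0 : Vec dz) i x = Function.update (0 : Vec dz) i y := by
      refine hinj (funext fun j => ?_)
      by_cases hj : j = i
      · subst hj
        simpa [statMap] using hxy
      · simp [statMap, hj]
    simpa using congrFun h i
  refine hsi ?_
  have h1 := congrFun (hL ((σ.permMatrix ℝ).mulVec a)) i
  have h2 := congrFun (hL ((σ.permMatrix ℝ).mulVec a')) i
  refine h1.trans (Eq.trans ?_ h2.symm)
  simp only [Pi.add_apply, Matrix.permMatrix_mulVec]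
  refine congrArg (· + b i) ?_
  unfold Matrix.mulVec dotProduct
  refine Finset.sum_congr rfl fun j _ => ?_
  by_cases hj : σ j = k
  · rw [← hj, mul_permMatrix_apply] at h0
    simp [h0]
  · simp [statMap, haa' _ hj]

end

end MechSparse

theorem mainTheorem4 {dz dx da T : ℕ} (A : Set (Vec da)) (σsq : ℝ≥0)
    (s h : Fin dz → ℝ → ℝ)
    (θ θ' : LatentModel dz dx da T) (lam lam' : NaturalParam dz da T)
    (hObsModel : ObservationModel θ) (hObsModel' : ObservationModel θ')
    (hIndep : CondIndependentLatents A θ) (hIndep' : CondIndependentLatents A θ')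
    (hMarkov : MarkovWrtGraph A θ) (hMarkov' : MarkovWrtGraph A θ')
    (hSmooth : SmoothTransitions A θ) (hSmooth' : SmoothTransitions A θ')
    (hExp : ExponentialFamily A s h lam θ) (hExp' : ExponentialFamily A s h lam' θ')
    (hObs : ObsEquiv A σsq θ θ')
    (hMin : ∀ i, MinimalStatistic (s i))
    (hVar : SufficientVariability A lam)
    (hs : IsDiffeoOntoImage (statMap s))
    (hInf : SufficientInfluence A s lam θ.Gz) :
    ∃ P : Matrix (Fin dz) (Fin dz) ℝ, IsPermMatrix P ∧
      SupportSubset (P * θ.Gz * P.transpose) θ'.Gz ∧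
      (l0 θ'.Gz ≤ l0 θ.Gz →
        ZConsistentWith A P θ θ' ∧
        QuasiLinearEquiv A s θ θ' ∧
        ∃ (C : Matrix (Fin dz) (Fin dz) ℝ) (b : Vec dz),
          IsUnit C ∧ PreservingMatrix θ.Gz C ∧ PreservingMatrix θ.Gz.transpose C ∧
          ∀ z, (C * P.transpose).mulVec (statMap s z) + b ∈ Set.range (statMap s) ∧
            entanglementMap θ.f θ'.f z =
              Function.invFun (statMap s) ((C * P.transpose).mulVec (statMap s z) + b)) := by
  -- The history with index `0` exists even when `dz = 0`; it yields `0 < T` and a point of `A`.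
  obtain ⟨t₀, zs₀, as₀, has₀⟩ : ∃ (t : Fin T) (_ : LatentPast dz t) (as : AuxPast da t),
      ∀ τ, as τ ∈ A := by
    obtain ⟨t, zs, as, has, -⟩ := hVar
    exact ⟨t 0, zs 0, as 0, has 0⟩
  have hd : ∀ i, Dense {x | 0 < h i x} := fun i => hExp.dense_baseMeasure_pos hIndep zs₀ has₀ i
  have hsc : ∀ i, Continuous (s i) := fun i => (contDiff_of_statMap hs.1 i).continuous
  have hDiff : DiffEquiv A θ θ' := diffEquiv_of_obsEquiv hObsModel hObsModel' hIndep hIndep'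
    hSmooth hSmooth' hExp hExp' hd hObs t₀.pos ⟨as₀ 0, has₀ 0⟩
  obtain ⟨hr, hv, htrans⟩ := id hDiff
  have hwc := contDiff_entanglementMap hObsModel'.2.1 hObsModel.2.1.1 hr.le
  have hwv := entanglementMap_leftInverse hObsModel'.2.1.injective hr.symm
  have hvw := entanglementMap_leftInverse hObsModel.2.1.injective hr
  set v := entanglementMap θ.f θ'.f
  set w := entanglementMap θ'.f θ.f
  have hdot := fun (t t₀ : Fin T) (zs : LatentPast dz t) (zs₀ : LatentPast dz t₀)
    (as : AuxPast da t) (as₀ : AuxPast da t₀) (has : ∀ τ, as τ ∈ A) (has₀ : ∀ τ, as₀ τ ∈ A) =>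
    exists_dotProduct_eq hExp hExp' hd hsc hv.1.1.continuous htrans zs zs₀ has has₀
  obtain ⟨L, b, hL⟩ := exists_statMap_eq_mulVec_add hvw hdot hVar
  obtain ⟨hsu, t, τ, zs, as, has, hspan⟩ := hInf
  have hLu : IsUnit L := isUnit_of_statMap_eq hs.1 hsu hv hL
  have hconj : ∀ M ∈ alignedSubspace θ.Gz, L.transpose * M * L ∈ alignedSubspace θ'.Gz := by
    refine conj_mem_alignedSubspace_of_span hspan fun r => ?_
    -- Evaluated at the `w`-images of the influence histories, so that `v` brings back exactly the
    -- spanning matrices.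
    have hjac := jacobianAt_mul_inv_eq hv.1.1 hs.1 hsu hL
      (differentiable_naturalParam hExp hSmooth hd hsc hMin (t r) (has r))
      (fun zs zs₀ => naturalParam_sub_eq hMin hL hdot zs zs₀ (has r) (has r)) (τ r)
      fun ρ => w (zs r ρ)
    simp only [hvw] at hjac
    rw [← hjac]
    exact mul_inv_jacobian_statMap_mem hs.1 _
      (jacobianAt_mem_alignedSubspace hMarkov' hExp' hSmooth' hd hsc hMin _ _ _ (has r))
  obtain ⟨σ, hσ⟩ := exists_perm_forall_ne_zero hLu
  have hsub : SupportSubset (σ.permMatrix ℝ * θ.Gz * (σ.permMatrix ℝ).transpose) θ'.Gz := by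
    intro k l hkl
    rw [permMatrix_conj_apply] at hkl
    exact edge_of_conj_mem_alignedSubspace hconj hkl (hσ k) (hσ l)
  refine ⟨σ.permMatrix ℝ, ⟨σ, rfl⟩, hsub, fun hl0 => ?_⟩
  have hG : σ.permMatrix ℝ * θ.Gz * (σ.permMatrix ℝ).transpose = θ'.Gz :=
    eq_of_supportSubset_of_l0_le (θ.Gz_binary.permMatrix_conj σ) θ'.Gz_binary hsub
      (hl0.trans (l0_permMatrix_conj σ θ.Gz).ge)
  -- Since `(L P) i (σ k) = L i k` and `G' k l = G (σ k) (σ l)`, the edge rule from `G` to `G'`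
  -- becomes an edge rule from `G` to itself.
  have hC : ∀ i j k l, θ.Gz i j ≠ 0 → (L * σ.permMatrix ℝ) i k ≠ 0 →
      (L * σ.permMatrix ℝ) j l ≠ 0 → θ.Gz k l ≠ 0 := by
    intro i j k l hij hik hjl
    obtain ⟨k, rfl⟩ := σ.surjective k
    obtain ⟨l, rfl⟩ := σ.surjective l
    rw [mul_permMatrix_apply] at hik hjl
    refine ((permMatrix_conj_apply σ θ.Gz k l).symm.trans (congrFun (congrFun hG k) l)).trans_ne ?_
    exact edge_of_conj_mem_alignedSubspace hconj hij hik hjl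
  have hdiag : ∀ k, (L * σ.permMatrix ℝ) k k ≠ 0 := by
    intro k
    obtain ⟨k, rfl⟩ := σ.surjective k
    rw [mul_permMatrix_apply]
    exact hσ k
  have hdep := mul_permMatrix_ne_zero_of_depGraph hs.injective hL σ
  -- The witnesses are `c = v ∘ P` and `C = L P`; `P Pᵀ = 1` recovers `v = c ∘ Pᵀ` and `L = C Pᵀ`.
  refine ⟨⟨hDiff, hG.symm, fun z => v ((σ.permMatrix ℝ).mulVec z),
    IsDiffeo.comp_permMatrix hv.1.1 hwc hwv hvw σ, preservingMatrix_of_support hC hdiag hdep,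
    preservingMatrix_transpose_of_support hC hdiag hdep, fun z => ?_⟩,
    ⟨hDiff, L, b, hLu, hL⟩, L * σ.permMatrix ℝ, b,
    hLu.mul (IsUnit.of_mul_eq_one _ (permMatrix_mul_transpose_self σ)),
    preservingMatrix_of_support hC hdiag fun _ _ => id,
    preservingMatrix_transpose_of_support hC hdiag fun _ _ => id, fun z => ?_⟩
  · simp only [Matrix.mulVec_mulVec, permMatrix_mul_transpose_self, Matrix.one_mulVec]
    rfl
  · rw [Matrix.mul_assoc, permMatrix_mul_transpose_self, Matrix.mul_one, ← hL]
    exact ⟨⟨v z, rfl⟩, (Function.leftInverse_invFun hs.injective (v z)).symm⟩
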